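/- Write $e(y)=e^{2\pi i y}$ and, for a Borel probability measure $\mu$ on $\mathbb R$ and $n\in\mathbb Z$, $\widehat\mu(n)=\int e(nx)\,d\mu(x)$. For a real number $x$, an integer $b\ge 2$ and $n\ge1$, let $x_n=\lfloor b^n\{x\}\rfloor \bmod b$ be the $n$-th base-$b$ digit of the fractional part $\{x\}$ of $x$; $x$ is called normal in base $b$ if for every $k\ge1$ and every block $(d_1,\dots,d_k)\in\{0,\dots,b-1\}^k$, $$\lim_{N\to\infty}\frac1N\#\bigl\{1\le n\le N:(x_n,\dots,x_{n+k-1})=(d_1,\dots,d_k)\bigr\}=b^{-k}.$$ Let $\mathcal K=(K_\ell)_{\ell\ge0}$ be a nondecreasing sequence of integers with $K_0=0$, and let $\varepsilon=(\varepsilon_\ell)_{\ell\ge1}$ be a sequence in $[0,1]$. Let $\mu[\mathcal K,\varepsilon]$ be the probability measure given by the infinite convolution $$\mu[\mathcal K,\varepsilon]=\mathop{\ast}_{\ell=1}^{\infty}\mu_\ell,\qquad \mu_\ell=\varepsilon_\ell\,\delta(0)+(1-\varepsilon_\ell)\mathop{\ast}_{k=K_{\ell-1}+1}^{K_\ell}\Bigl[\tfrac12\delta(0)+\tfrac12\delta(2^{-k})\Bigr],$$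 (an empty convolution is $\delta(0)$), i.e. the law of a sum of independent random variables with laws $\mu_1,\mu_2,\dots$. Say that a probability measure $\mu$ on $\mathbb R$ has property (P) if * for every odd integer $r\ge3$ and every integer $h\ne0$, $$\sum_{N=1}^{\infty}N^{-3}\sum_{v=1}^{N}\sum_{u=1}^{N}\bigl|\widehat\mu\bigl(hr^u(r^v-1)\bigr)\bigr|<\infty;$$ * $\mu$-almost every $x$ lies in $[0,1)$ and is normal in every odd base $r\ge3$. **Proposition 4.2.** Let $K\ge10$ be an integer. (i) There are a strictly increasing sequence of integers $\mathcal K=(K_\ell)_{\ell\ge0}$ with $K_0=0$ and a sequence $\varepsilon=(\varepsilon_\ell)_{\ell\ge1}$ in $[0,1]$ with $\sum_\ell\varepsilon_\ell=\infty$ such that $\mu[\mathcal K,\varepsilon]$ has property (P). Moreover, one can take $\varepsilon_\ell=1/\ell$ for all $\ell\ge1$ and $K_\ell=K^{\ell\lfloor\sqrt{\log\ell}\rfloor}$ for all $\ell\ge3$. (ii) Property (P) also holds for $\mu[\mathcal K,\varepsilon]$ when $K_0=0$, $K_\ell=K^{\ell\lfloor\sqrt{\log\ell}\rfloor}$ and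 $\varepsilon_\ell=1/\ell$ for all $\ell\ge1$ (here $K_1=K_2=1$, so that the second block is empty and $\mu_2=\delta(0)$). -/

import Mathlib

open MeasureTheory ProbabilityTheory Filter
open scoped Topology unitInterval BigOperators

noncomputable section

namespace OddNormal

/-! ### Normal numbers -/

/-- The `n`-th digit (`n ≥ 1`) after the radix point of the fractional part of `x` in base `b`. -/
def digit (b : ℕ) (x : ℝ) (n : ℕ) : ℕ :=
  ⌊Int.fract x * (b : ℝ) ^ n⌋₊ % b

/-- `x` is normal in base `b`: every block of `k ≥ 1` digits occurs in the base-`b` expansion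
of (the fractional part of) `x` with asymptotic frequency `b ^ (-k)`. -/
def IsNormalInBase (b : ℕ) (x : ℝ) : Prop :=
  ∀ k : ℕ, 1 ≤ k → ∀ d : Fin k → Fin b,
    Tendsto
      (fun N : ℕ =>
        (({n ∈ Finset.Icc 1 N | ∀ i : Fin k, digit b x (n + (i : ℕ)) = (d i : ℕ)}.card : ℕ) : ℝ)
          / (N : ℝ))
      atTop (𝓝 (1 / (b : ℝ) ^ k))

/-- The set of real numbers that are normal in every base `b ∈ B`. -/
def normalSet (B : Set ℕ) : Set ℝ := {x | ∀ b ∈ B, IsNormalInBase b x}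

/-- The odd integers in `{2, 3, 4, …}`. -/
def oddBases : Set ℕ := {b | 2 ≤ b ∧ Odd b}

/-! ### Finite and infinite convolutions of probability measures -/

/-- The finite convolution `ν 0 ∗ ν 1 ∗ ⋯ ∗ ν (n - 1)`; the empty convolution is `δ(0)`. -/
def finConv (ν : ℕ → Measure ℝ) : ℕ → Measure ℝ
  | 0 => Measure.dirac 0
  | n + 1 => (finConv ν n).conv (ν n)

instance finConv_isProbabilityMeasure (ν : ℕ → Measure ℝ) [∀ i, IsProbabilityMeasure (ν i)]
    (n : ℕ) : IsProbabilityMeasure (finConv ν n) := by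
  induction n with
  | zero => unfold finConv; infer_instance
  | succ n ih => unfold finConv; infer_instance

/-- The infinite convolution `ν 0 ∗ ν 1 ∗ ν 2 ∗ ⋯`: the law of the sum `x 0 + x 1 + x 2 + ⋯` of
independent random variables `x i` with laws `ν i` (meaningful when this sum converges almost
surely; see `tendsto_finConv` for the weak convergence of the finite convolutions). -/
def infConv (ν : ℕ → Measure ℝ) [∀ i, IsProbabilityMeasure (ν i)] : Measure ℝ :=
  (Measure.infinitePi ν).map (fun x : ℕ → ℝ => ∑' i, x i)

lemma measurable_tsum_coord : Measurable (fun x : ℕ → ℝ => ∑' i, x i) :=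
  Measurable.tsum (fun i => measurable_pi_apply i)

instance infConv_isProbabilityMeasure (ν : ℕ → Measure ℝ) [∀ i, IsProbabilityMeasure (ν i)] :
    IsProbabilityMeasure (infConv ν) :=
  Measure.isProbabilityMeasure_map measurable_tsum_coord.aemeasurable

lemma map_sum_range_infinitePi (ν : ℕ → Measure ℝ) [∀ i, IsProbabilityMeasure (ν i)] (n : ℕ) :
    (Measure.infinitePi ν).map (fun x : ℕ → ℝ => ∑ i ∈ Finset.range n, x i) = finConv ν n := by
  induction n with
  | zero => simp [finConv]
  | succ n ih =>
    have hind : iIndepFun (fun (i : ℕ) (x : ℕ → ℝ) => x i) (Measure.infinitePi ν) :=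
      iIndepFun_infinitePi (X := fun _ x => x) (fun _ => measurable_id)
    have h2 := hind.indepFun_finsetSum_of_notMem (fun i => measurable_pi_apply i)
      (Finset.notMem_range_self (n := n))
    have h3 := h2.map_add_eq_map_conv_map₀ (by fun_prop)
      (measurable_pi_apply n).aemeasurable
    have e1 : (∑ j ∈ Finset.range n, fun x : ℕ → ℝ => x j)
        = fun x : ℕ → ℝ => ∑ i ∈ Finset.range n, x i := by
      ext x; simp
    rw [e1, ih, Measure.infinitePi_map_eval] at h3
    rw [finConv, ← h3]
    congr 1
    ext x
    simp [Finset.sum_range_succ]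

/-- If the random series converges almost surely, then the finite convolutions converge weakly
to the infinite convolution. -/
theorem tendsto_finConv (ν : ℕ → Measure ℝ) [∀ i, IsProbabilityMeasure (ν i)]
    (hν : ∀ᵐ x ∂(Measure.infinitePi ν), Summable x) (f : BoundedContinuousFunction ℝ ℝ) :
    Tendsto (fun n => ∫ y, f y ∂(finConv ν n)) atTop (𝓝 (∫ y, f y ∂(infConv ν))) := by
  simp only [← map_sum_range_infinitePi, infConv]
  rw [integral_map measurable_tsum_coord.aemeasurable
    f.continuous.measurable.aestronglyMeasurable]
  have h (n : ℕ) : ∫ y, f y ∂((Measure.infinitePi ν).map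
        (fun x : ℕ → ℝ => ∑ i ∈ Finset.range n, x i))
      = ∫ x, f (∑ i ∈ Finset.range n, x i) ∂(Measure.infinitePi ν) :=
    integral_map (by fun_prop) f.continuous.measurable.aestronglyMeasurable
  simp only [h]
  refine tendsto_integral_of_dominated_convergence (fun _ => ‖f‖) ?_ (integrable_const _) ?_ ?_
  · intro n
    exact (f.continuous.measurable.comp (by fun_prop)).aestronglyMeasurable
  · intro n
    exact Eventually.of_forall fun x => f.norm_coe_le_norm _
  · filter_upwards [hν] with x hx
    exact (f.continuous.tendsto _).comp hx.hasSum.tendsto_sum_nat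

/-! ### The measure `μ[𝒦, ε]` -/

/-- The measure `½ δ(0) + ½ δ(2^{-k})`. -/
def coin (k : ℕ) : Measure ℝ :=
  ENNReal.ofReal (1 / 2) • Measure.dirac 0 + ENNReal.ofReal (1 / 2) • Measure.dirac ((2 : ℝ)⁻¹ ^ k)

instance coin_isProbabilityMeasure (k : ℕ) : IsProbabilityMeasure (coin k) := by
  constructor
  simp only [coin, Measure.add_apply, Measure.smul_apply, measure_univ, smul_eq_mul, mul_one]
  rw [← ENNReal.ofReal_add (by norm_num) (by norm_num)]
  norm_num

/-- The convolution of the measures `½ δ(0) + ½ δ(2^{-k})` over the `ℓ`-th block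
`K (ℓ - 1) < k ≤ K ℓ` (`ℓ ≥ 1`). -/
def blockConv (K : ℕ → ℕ) (l : ℕ) : Measure ℝ :=
  finConv (fun j => coin (K (l - 1) + 1 + j)) (K l - K (l - 1))

instance blockConv_isProbabilityMeasure (K : ℕ → ℕ) (l : ℕ) :
    IsProbabilityMeasure (blockConv K l) := by
  unfold blockConv; infer_instance

/-- The measure `μ_ℓ = ε_ℓ δ(0) + (1 - ε_ℓ) ∗_{K (ℓ-1) < k ≤ K ℓ} [½ δ(0) + ½ δ(2^{-k})]`. -/
def blockMeasure (K : ℕ → ℕ) (ε : ℕ → I) (l : ℕ) : Measure ℝ :=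
  ENNReal.ofReal (ε l) • Measure.dirac 0 + ENNReal.ofReal (1 - ε l) • blockConv K l

instance blockMeasure_isProbabilityMeasure (K : ℕ → ℕ) (ε : ℕ → I) (l : ℕ) :
    IsProbabilityMeasure (blockMeasure K ε l) := by
  constructor
  simp only [blockMeasure, Measure.add_apply, Measure.smul_apply, measure_univ, smul_eq_mul,
    mul_one]
  rw [← ENNReal.ofReal_add (ε l).2.1 (by linarith [(ε l).2.2])]
  simp

/-- The measure `μ[𝒦, ε] = μ_1 ∗ μ_2 ∗ μ_3 ∗ ⋯`. The value `ε 0` is not used. -/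
def skewMeasure (K : ℕ → ℕ) (ε : ℕ → I) : Measure ℝ :=
  infConv (fun i => blockMeasure K ε (i + 1))

instance skewMeasure_isProbabilityMeasure (K : ℕ → ℕ) (ε : ℕ → I) :
    IsProbabilityMeasure (skewMeasure K ε) := by
  unfold skewMeasure; infer_instance

lemma coin_mem_Icc (k : ℕ) : ∀ᵐ x ∂(coin k), x ∈ Set.Icc (0 : ℝ) ((2 : ℝ)⁻¹ ^ k) := by
  rw [coin, ae_add_measure_iff]
  constructor
  · refine Measure.ae_smul_measure ?_ _
    exact (ae_dirac_iff measurableSet_Icc).2 ⟨le_refl _, by positivity⟩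
  · refine Measure.ae_smul_measure ?_ _
    exact (ae_dirac_iff measurableSet_Icc).2 ⟨by positivity, le_refl _⟩

lemma finConv_mem_Icc (ν : ℕ → Measure ℝ) [∀ i, IsProbabilityMeasure (ν i)] (c : ℕ → ℝ)
    (hc : ∀ i, ∀ᵐ x ∂(ν i), x ∈ Set.Icc (0 : ℝ) (c i)) (n : ℕ) :
    ∀ᵐ x ∂(finConv ν n), x ∈ Set.Icc (0 : ℝ) (∑ i ∈ Finset.range n, c i) := by
  rw [← map_sum_range_infinitePi]
  refine (ae_map_iff (by fun_prop) measurableSet_Icc).2 ?_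
  have h : ∀ᵐ x ∂(Measure.infinitePi ν), ∀ i, x i ∈ Set.Icc (0 : ℝ) (c i) :=
    ae_all_iff.2 fun i => (measurePreserving_eval_infinitePi ν i).quasiMeasurePreserving.ae (hc i)
  filter_upwards [h] with x hx
  exact ⟨Finset.sum_nonneg fun i _ => (hx i).1, Finset.sum_le_sum fun i _ => (hx i).2⟩

lemma blockMeasure_mem_Icc (K : ℕ → ℕ) (hK : Monotone K) (ε : ℕ → I) (l : ℕ) :
    ∀ᵐ x ∂(blockMeasure K ε (l + 1)),
      x ∈ Set.Icc (0 : ℝ) ((2 : ℝ)⁻¹ ^ K l - (2 : ℝ)⁻¹ ^ K (l + 1)) := by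
  have hle : K l ≤ K (l + 1) := hK (Nat.le_succ l)
  have hsum (a n : ℕ) : ∑ j ∈ Finset.range n, (2 : ℝ)⁻¹ ^ (a + 1 + j)
      = (2 : ℝ)⁻¹ ^ a - (2 : ℝ)⁻¹ ^ (a + n) := by
    induction n with
    | zero => simp
    | succ n ih => rw [Finset.sum_range_succ, ih]; ring
  rw [blockMeasure, ae_add_measure_iff]
  constructor
  · refine Measure.ae_smul_measure ?_ _
    refine (ae_dirac_iff measurableSet_Icc).2 ⟨le_refl _, sub_nonneg.2 ?_⟩
    exact pow_le_pow_of_le_one (by norm_num) (by norm_num) hle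
  · refine Measure.ae_smul_measure ?_ _
    have h := finConv_mem_Icc (fun j => coin (K l + 1 + j)) _ (fun j => coin_mem_Icc _)
      (K (l + 1) - K l)
    rw [hsum, Nat.add_sub_of_le hle] at h
    exact h

/-- For every nondecreasing `K`, the measure `skewMeasure K ε` is the weak limit of the finite
convolutions `μ_1 ∗ ⋯ ∗ μ_n`. -/
theorem tendsto_skewMeasure (K : ℕ → ℕ) (hK : Monotone K) (ε : ℕ → I)
    (f : BoundedContinuousFunction ℝ ℝ) :
    Tendsto (fun n => ∫ y, f y ∂(finConv (fun i => blockMeasure K ε (i + 1)) n)) atTop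
      (𝓝 (∫ y, f y ∂(skewMeasure K ε))) := by
  refine tendsto_finConv _ ?_ f
  have h : ∀ᵐ x ∂(Measure.infinitePi fun i => blockMeasure K ε (i + 1)), ∀ i,
      x i ∈ Set.Icc (0 : ℝ) ((2 : ℝ)⁻¹ ^ K i - (2 : ℝ)⁻¹ ^ K (i + 1)) :=
    ae_all_iff.2 fun i =>
      (measurePreserving_eval_infinitePi (fun i => blockMeasure K ε (i + 1))
        i).quasiMeasurePreserving.ae (blockMeasure_mem_Icc K hK ε i)
  filter_upwards [h] with x hx
  refine summable_of_sum_range_le (c := (2 : ℝ)⁻¹ ^ K 0) (fun i => (hx i).1) fun n => ?_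
  calc ∑ i ∈ Finset.range n, x i
      ≤ ∑ i ∈ Finset.range n, ((2 : ℝ)⁻¹ ^ K i - (2 : ℝ)⁻¹ ^ K (i + 1)) :=
        Finset.sum_le_sum fun i _ => (hx i).2
    _ = (2 : ℝ)⁻¹ ^ K 0 - (2 : ℝ)⁻¹ ^ K n := Finset.sum_range_sub' _ _
    _ ≤ (2 : ℝ)⁻¹ ^ K 0 := sub_le_self _ (by positivity)

/-! ### The parameters -/

/-- The standing assumptions on the parameters: `𝒦` is a strictly increasing sequence of integers with `𝒦_0 = 0`, and
`∑ ε_ℓ = ∞` (the condition `ε_ℓ ∈ [0, 1]` is part of the type). -/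
def IsParameterChoice (K : ℕ → ℕ) (ε : ℕ → I) : Prop :=
  StrictMono K ∧ K 0 = 0 ∧ ¬ Summable (fun l : ℕ => (ε (l + 1) : ℝ))

/-- `K_0 = 0` and `K_ℓ = K ^ (ℓ ⌊√(log ℓ)⌋)` for `ℓ ≥ 1`. -/
def specialK (K : ℕ) (l : ℕ) : ℕ :=
  if l = 0 then 0 else K ^ (l * ⌊Real.sqrt (Real.log (l : ℝ))⌋₊)

/-- `ε_ℓ = 1 / ℓ` for `ℓ ≥ 1`. -/
def specialEps (l : ℕ) : I :=
  ⟨1 / (l : ℝ), by positivity, by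
    rcases Nat.eq_zero_or_pos l with rfl | h
    · simp
    · rw [div_le_one (by exact_mod_cast h)]
      exact_mod_cast h⟩

/-! ### Fourier coefficients and the property of the measure -/

/-- The Fourier coefficient `∫ e(n x) dμ(x)`, where `e(y) = exp(2 π i y)`. -/
def fourierCoefficient (μ : Measure ℝ) (n : ℤ) : ℂ :=
  ∫ x, Complex.exp (2 * (Real.pi : ℂ) * Complex.I * ((n : ℂ) * (x : ℂ))) ∂μ

/-- `I(h; r, N) = ∑_{v=1}^N ∑_{u=1}^N |μ̂(h r^u (r^v - 1))|`. -/
def fourierDoubleSum (μ : Measure ℝ) (h : ℤ) (r N : ℕ) : ℝ :=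
  ∑ v ∈ Finset.Icc 1 N, ∑ u ∈ Finset.Icc 1 N,
    ‖fourierCoefficient μ (h * (r : ℤ) ^ u * ((r : ℤ) ^ v - 1))‖

/-- The series `∑_N N^{-3} I(h; r, N)` converges for every odd `r ≥ 3` and every `h ≠ 0`
(the term `N = 0` is zero), and `μ`-almost every point lies in `[0, 1)` and is normal in every
odd base. -/
def HasOddBaseProperty (μ : Measure ℝ) : Prop :=
  (∀ r ∈ oddBases, ∀ h : ℤ, h ≠ 0 →
    Summable (fun N : ℕ => fourierDoubleSum μ h r N / (N : ℝ) ^ 3)) ∧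
  ∀ᵐ x ∂μ, x ∈ normalSet oddBases ∩ Set.Ico (0 : ℝ) 1

end OddNormal

end

open MeasureTheory ProbabilityTheory Filter
open scoped Topology unitInterval BigOperators

noncomputable section

namespace OddNormal

/-! ### Fourier coefficients of infinite convolutions -/

/-! The Fourier transform of a block is bounded by `ε + (1 - ε) ∏ |cos (π n / 2 ^ k)|`, the product
running over the binary positions `k` of the block, and a factor of this product is small or large
according to the binary digits of `n` near position `k`. The point is that the binary digits of `h
r^u (r^v - 1)` behave, on average over `u`, like independent coin tosses when `r` is odd. Indeed `r
^ 2 ^ (j + 1) = 1 + 2 ^ (s + j) * odd`, so shifting `u` by `2 ^ (j + 1)` flips one digit and keeps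
all lower ones (`shiftFlips_geometric`). The flip turns a cosine into a sine, and `|cos| + |sin| ≤
√2`, so each position gains a factor `1/√2` on average. Hence the average over `u` is at most a
product of terms `ε_l + 2 ^ (-d_l / 2)`, with `d_l` the block length
(`ShiftFlips.sum_prod_blockFactor_le`).

Digits below the 2-adic valuation of `h (r^v - 1)` carry no information. That valuation is large
only if a high power of 2 divides `v`, which is rare, and such `v` are estimated trivially
(`fourierDoubleSum_skewMeasure_le`).

For `2 ^ K_L ≤ N < 2 ^ K_{L+1}` the blocks between `M = L / 2` and `L` are used. Each contributes at
most `2 / M`, and since `⌊√(log l)⌋` grows slowly, `(2 / M) ^ (L - M)` is at most `K_{L+1} ^ (-2)`,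
hence `O((log N) ^ (-2))` (`IsSpecialChoice.eventually_sq_le`). The series is thus dominated by `∑ 1
/ (N (log N) ^ 2)`.

Normality follows from the Davenport–Erdős–LeVeque argument (`ae_tendsto_average_expChar`) and
Weyl's criterion (`isNormalInBase_of_tendsto_average`), applied to the countably many pairs `(r,
h)`. -/

lemma fourierCoefficient_eq_charFun (μ : Measure ℝ) (n : ℤ) :
    fourierCoefficient μ n = charFun μ (2 * Real.pi * n) := by
  rw [fourierCoefficient, charFun_apply_real]
  congr 1
  ext x
  congr 1
  push_cast
  ring

lemma charFun_finConv (ν : ℕ → Measure ℝ) [∀ i, IsProbabilityMeasure (ν i)] (n : ℕ) (t : ℝ) :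
    charFun (finConv ν n) t = ∏ i ∈ Finset.range n, charFun (ν i) t := by
  induction n with
  | zero => simp [finConv]
  | succ n ih => rw [finConv, charFun_conv, ih, Finset.prod_range_succ]

lemma charFun_mixture (a b : ℝ) (ha : 0 ≤ a) (hb : 0 ≤ b) (μ ν : Measure ℝ)
    [IsProbabilityMeasure μ] [IsProbabilityMeasure ν] (t : ℝ) :
    charFun (ENNReal.ofReal a • μ + ENNReal.ofReal b • ν) t
      = a * charFun μ t + b * charFun ν t := by
  have key (ρ : Measure ℝ) [IsProbabilityMeasure ρ] (c : ℝ) :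
      Integrable (fun x : ℝ => Complex.exp (t * x * Complex.I)) (ENNReal.ofReal c • ρ) := by
    refine Integrable.smul_measure ?_ ENNReal.ofReal_ne_top
    refine (integrable_const (1 : ℝ)).mono' (by fun_prop) (Eventually.of_forall fun x => ?_)
    rw [← Complex.ofReal_mul, Complex.norm_exp_ofReal_mul_I]
  simp only [charFun_apply_real]
  rw [integral_add_measure (key μ a) (key ν b), integral_smul_measure, integral_smul_measure,
    ENNReal.toReal_ofReal ha, ENNReal.toReal_ofReal hb]
  simp

/-- Half-angle identity `(1 + e^{2iy}) / 2 = e^{iy} cos y`. -/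
lemma norm_charFun_coin (k : ℕ) (t : ℝ) :
    ‖charFun (coin k) t‖ = |Real.cos (t * (2 : ℝ)⁻¹ ^ k / 2)| := by
  rw [coin, charFun_mixture _ _ (by norm_num) (by norm_num), charFun_dirac, charFun_dirac]
  simp only [inner_zero_left, Complex.ofReal_zero, zero_mul, Complex.exp_zero, mul_one]
  set y : ℝ := t * (2 : ℝ)⁻¹ ^ k / 2 with hy
  have h1 : inner ℝ ((2 : ℝ)⁻¹ ^ k) t = y + y := by
    simp only [RCLike.inner_apply, conj_trivial, hy]
    ring
  have h2 : ((1 / 2 : ℝ) : ℂ) + ((1 / 2 : ℝ) : ℂ) * Complex.exp (((y + y : ℝ) : ℂ) * Complex.I)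
      = Complex.exp (y * Complex.I) * (Real.cos y : ℝ) := by
    rw [Complex.ofReal_cos, Complex.cos]
    have e1 : Complex.exp (y * Complex.I) * Complex.exp (-y * Complex.I) = 1 := by
      rw [← Complex.exp_add]; simp
    have e2 : Complex.exp (((y + y : ℝ) : ℂ) * Complex.I)
        = Complex.exp (y * Complex.I) * Complex.exp (y * Complex.I) := by
      rw [← Complex.exp_add]; push_cast; ring_nf
    rw [e2]
    push_cast
    linear_combination (-1 / 2 : ℂ) * e1
  rw [h1, h2, norm_mul, Complex.norm_exp_ofReal_mul_I, one_mul, Complex.norm_real,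
    Real.norm_eq_abs]

/-- The bound for the Fourier transform of the `(l + 1)`-th block measure at the integer `n`. -/
def blockFactor (K : ℕ → ℕ) (ε : ℕ → I) (n : ℤ) (l : ℕ) : ℝ :=
  ε (l + 1) + (1 - ε (l + 1)) *
    ∏ j ∈ Finset.range (K (l + 1) - K l), |Real.cos (Real.pi * n / 2 ^ (K l + 1 + j))|

lemma blockFactor_nonneg (K : ℕ → ℕ) (ε : ℕ → I) (n : ℤ) (l : ℕ) :
    0 ≤ blockFactor K ε n l :=
  add_nonneg (ε (l + 1)).2.1 (mul_nonneg (sub_nonneg.2 (ε (l + 1)).2.2)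
    (Finset.prod_nonneg fun _ _ => abs_nonneg _))

lemma norm_charFun_blockMeasure_le (K : ℕ → ℕ) (ε : ℕ → I) (n : ℤ) (l : ℕ) :
    ‖charFun (blockMeasure K ε (l + 1)) (2 * Real.pi * n)‖ ≤ blockFactor K ε n l := by
  have h1 : (0 : ℝ) ≤ ε (l + 1) := (ε (l + 1)).2.1
  have h2 : (0 : ℝ) ≤ 1 - ε (l + 1) := sub_nonneg.2 (ε (l + 1)).2.2
  rw [blockMeasure, charFun_mixture _ _ h1 h2, charFun_dirac, blockConv, charFun_finConv]
  refine (norm_add_le _ _).trans ?_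
  simp only [inner_zero_left, Complex.ofReal_zero, zero_mul, Complex.exp_zero, mul_one, norm_mul,
    Complex.norm_real, Real.norm_of_nonneg h1, Real.norm_of_nonneg h2, norm_prod,
    norm_charFun_coin, blockFactor, Nat.add_sub_cancel]
  refine le_of_eq ?_
  congr 2
  refine Finset.prod_congr rfl fun j _ => ?_
  congr 2
  field_simp
  rw [mul_assoc, ← mul_pow]
  norm_num

/-- Weak convergence is available for real test functions, hence the split into cosine and sine. -/
lemma tendsto_charFun_skewMeasure (K : ℕ → ℕ) (hK : Monotone K) (ε : ℕ → I) (t : ℝ) :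
    Tendsto (fun n => charFun (finConv (fun i => blockMeasure K ε (i + 1)) n) t) atTop
      (𝓝 (charFun (skewMeasure K ε) t)) := by
  have key (ρ : Measure ℝ) [IsProbabilityMeasure ρ] : charFun ρ t
      = ((∫ x, Real.cos (t * x) ∂ρ : ℝ) : ℂ) + ((∫ x, Real.sin (t * x) ∂ρ : ℝ) : ℂ)
        * Complex.I := by
    have i1 : Integrable (fun x : ℝ => Real.cos (t * x)) ρ :=
      (integrable_const (1 : ℝ)).mono' (by fun_prop)
        (Eventually.of_forall fun x => Real.abs_cos_le_one _)
    have i2 : Integrable (fun x : ℝ => Real.sin (t * x)) ρ :=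
      (integrable_const (1 : ℝ)).mono' (by fun_prop)
        (Eventually.of_forall fun x => Real.abs_sin_le_one _)
    rw [charFun_apply_real, ← integral_complex_ofReal, ← integral_complex_ofReal,
      ← integral_mul_const, ← integral_add i1.ofReal (i2.ofReal.mul_const _)]
    congr 1
    ext x
    rw [← Complex.ofReal_mul, Complex.exp_mul_I]
    push_cast
    rfl
  let c : BoundedContinuousFunction ℝ ℝ := BoundedContinuousFunction.ofNormedAddCommGroup
    (fun x => Real.cos (t * x)) (by fun_prop) 1 (fun x => Real.abs_cos_le_one _)
  let s : BoundedContinuousFunction ℝ ℝ := BoundedContinuousFunction.ofNormedAddCommGroup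
    (fun x => Real.sin (t * x)) (by fun_prop) 1 (fun x => Real.abs_sin_le_one _)
  simp only [key]
  have hc := tendsto_skewMeasure K hK ε c
  have hs := tendsto_skewMeasure K hK ε s
  exact ((Complex.continuous_ofReal.tendsto _).comp hc).add
    (((Complex.continuous_ofReal.tendsto _).comp hs).mul_const _)

/-- Factors outside the window have modulus at most 1. Low blocks must be dropped because their
digits may not vary with `u`, high blocks because their period in `u` may exceed `N`. -/
lemma norm_fourierCoefficient_skewMeasure_le (K : ℕ → ℕ) (hK : Monotone K) (ε : ℕ → I) (n : ℤ)
    (M L : ℕ) :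
    ‖fourierCoefficient (skewMeasure K ε) n‖ ≤ ∏ l ∈ Finset.Ico M L, blockFactor K ε n l := by
  rw [fourierCoefficient_eq_charFun]
  refine le_of_tendsto (tendsto_charFun_skewMeasure K hK ε _).norm ?_
  filter_upwards [eventually_ge_atTop L] with N hN
  rw [charFun_finConv, norm_prod]
  have hsub : Finset.Ico M L ⊆ Finset.range N := fun x hx => by
    simp only [Finset.mem_Ico, Finset.mem_range] at hx ⊢
    omega
  rw [← Finset.prod_sdiff hsub]
  calc _ ≤ 1 * ∏ l ∈ Finset.Ico M L, blockFactor K ε n l := by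
        refine mul_le_mul ?_ ?_ (Finset.prod_nonneg fun _ _ => norm_nonneg _) zero_le_one
        · exact Finset.prod_le_one (fun _ _ => norm_nonneg _) fun _ _ => norm_charFun_le_one _
        · exact Finset.prod_le_prod (fun _ _ => norm_nonneg _) fun l _ =>
            norm_charFun_blockMeasure_le K ε n l
    _ = _ := one_mul _

lemma norm_fourierCoefficient_le_one (μ : Measure ℝ) [IsProbabilityMeasure μ] (n : ℤ) :
    ‖fourierCoefficient μ n‖ ≤ 1 := by
  rw [fourierCoefficient_eq_charFun]
  exact norm_charFun_le_one _

lemma norm_fourierCoefficient_neg (μ : Measure ℝ) (n : ℤ) :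
    ‖fourierCoefficient μ (-n)‖ = ‖fourierCoefficient μ n‖ := by
  rw [fourierCoefficient_eq_charFun, fourierCoefficient_eq_charFun, Int.cast_neg, mul_neg,
    charFun_neg, RCLike.norm_conj]

/-! ### Averages of cosine products along geometric progressions -/

/-- Shifting the index of `n` by `2 ^ (j + 1)` flips the binary digit `a + j` of `n u` and keeps the
lower ones. -/
def ShiftFlips (n : ℕ → ℤ) (a : ℕ) : Prop :=
  ∀ j u : ℕ, ∃ c : ℤ, Odd c ∧ n (u + 2 ^ (j + 1)) = n u + 2 ^ (a + j) * c

lemma abs_cos_add_int_mul_pi (y : ℝ) (c : ℤ) : |Real.cos (y + c * Real.pi)| = |Real.cos y| := by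
  rw [Real.cos_add_int_mul_pi, abs_mul, abs_zpow]
  simp

lemma ShiftFlips.abs_cos_periodic {n : ℕ → ℤ} {a : ℕ} (hn : ShiftFlips n a) {j i : ℕ}
    (hij : i ≤ j) (u : ℕ) :
    |Real.cos (Real.pi * n (u + 2 ^ (j + 1)) / 2 ^ (a + i))|
      = |Real.cos (Real.pi * n u / 2 ^ (a + i))| := by
  obtain ⟨c, -, hc⟩ := hn j u
  obtain ⟨d, rfl⟩ := Nat.exists_eq_add_of_le hij
  rw [hc, ← abs_cos_add_int_mul_pi (Real.pi * n u / 2 ^ (a + i)) (2 ^ d * c)]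
  congr 2
  push_cast
  field_simp
  ring

/-- The shift moves the angle by an odd multiple of `π / 2`. -/
lemma ShiftFlips.abs_cos_flip {n : ℕ → ℤ} {a : ℕ} (hn : ShiftFlips n a) (j u : ℕ) :
    |Real.cos (Real.pi * n (u + 2 ^ (j + 1)) / 2 ^ (a + j + 1))|
      = |Real.sin (Real.pi * n u / 2 ^ (a + j + 1))| := by
  obtain ⟨c, ⟨d, rfl⟩, hc⟩ := hn j u
  have h : Real.pi * n (u + 2 ^ (j + 1)) / 2 ^ (a + j + 1)
      = (Real.pi * n u / 2 ^ (a + j + 1) + Real.pi / 2) + d * Real.pi := by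
    rw [hc]
    push_cast
    field_simp
    ring
  rw [h, abs_cos_add_int_mul_pi, Real.cos_add_pi_div_two, abs_neg]

lemma abs_cos_add_abs_sin_le (y : ℝ) : |Real.cos y| + |Real.sin y| ≤ √2 := by
  refine Real.le_sqrt_of_sq_le ?_
  nlinarith [sq_nonneg (|Real.cos y| - |Real.sin y|), sq_abs (Real.cos y), sq_abs (Real.sin y),
    Real.sin_sq_add_cos_sq y]

/-- Pairing `u` with `u + 2 ^ (j + 1)` leaves `G` unchanged and pairs a cosine with the
corresponding sine. Doubling the range thus costs `√2` rather than 2. -/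
lemma ShiftFlips.sum_mul_abs_cos_le {n : ℕ → ℤ} {a : ℕ} (hn : ShiftFlips n a) (j : ℕ)
    (G : ℕ → ℝ) (hG : ∀ u, 0 ≤ G u) (hper : ∀ u, G (u + 2 ^ (j + 1)) = G u) :
    ∑ u ∈ Finset.range (2 ^ (j + 2)), G u * |Real.cos (Real.pi * n u / 2 ^ (a + j + 1))|
      ≤ √2 * ∑ u ∈ Finset.range (2 ^ (j + 1)), G u := by
  have e : 2 ^ (j + 2) = 2 ^ (j + 1) + 2 ^ (j + 1) := by ring
  rw [e, Finset.sum_range_add, ← Finset.sum_add_distrib, Finset.mul_sum]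
  refine Finset.sum_le_sum fun u _ => ?_
  rw [add_comm (2 ^ (j + 1)) u, hper, hn.abs_cos_flip, ← mul_add, mul_comm]
  exact mul_le_mul_of_nonneg_right (abs_cos_add_abs_sin_le _) (hG u)

lemma periodic_two_pow_mono {G : ℕ → ℝ} {i : ℕ} (hper : ∀ u, G (u + 2 ^ i) = G u) (t u : ℕ) :
    G (u + 2 ^ (i + t)) = G u := by
  have h : Function.Periodic G (2 ^ i) := hper
  have := h.nat_mul (2 ^ t) u
  rw [show 2 ^ (i + t) = ((2 ^ t : ℕ) : ℕ) * 2 ^ i by ring]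
  exact_mod_cast this

lemma sum_range_two_pow_of_periodic {G : ℕ → ℝ} {i : ℕ} (hper : ∀ u, G (u + 2 ^ i) = G u)
    (t : ℕ) :
    ∑ u ∈ Finset.range (2 ^ (i + t)), G u = 2 ^ t * ∑ u ∈ Finset.range (2 ^ i), G u := by
  induction t with
  | zero => simp
  | succ t ih =>
    have e : 2 ^ (i + (t + 1)) = 2 ^ (i + t) + 2 ^ (i + t) := by ring
    rw [e, Finset.sum_range_add]
    simp only [add_comm (2 ^ (i + t)) _, periodic_two_pow_mono hper]
    rw [ih]
    ring

/-- One position at a time: the factors already treated involve lower digits only, so they can be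
absorbed into the periodic weight `G`. -/
lemma ShiftFlips.sum_mul_prod_abs_cos_le {n : ℕ → ℤ} {a : ℕ} (hn : ShiftFlips n a) (j t : ℕ)
    (G : ℕ → ℝ) (hG : ∀ u, 0 ≤ G u) (hper : ∀ u, G (u + 2 ^ (j + 1)) = G u) :
    ∑ u ∈ Finset.range (2 ^ (j + 1 + t)),
        G u * ∏ i ∈ Finset.range t, |Real.cos (Real.pi * n u / 2 ^ (a + j + 1 + i))|
      ≤ √2 ^ t * ∑ u ∈ Finset.range (2 ^ (j + 1)), G u := by
  induction t with
  | zero => simp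
  | succ t ih =>
    have hper' : ∀ u,
        G (u + 2 ^ (j + t + 1)) * ∏ i ∈ Finset.range t,
            |Real.cos (Real.pi * n (u + 2 ^ (j + t + 1)) / 2 ^ (a + j + 1 + i))|
          = G u * ∏ i ∈ Finset.range t, |Real.cos (Real.pi * n u / 2 ^ (a + j + 1 + i))| := by
      intro u
      have e1 := periodic_two_pow_mono hper t u
      rw [show j + 1 + t = j + t + 1 by ring] at e1
      rw [e1]
      congr 1
      refine Finset.prod_congr rfl fun i hi => ?_
      have := Finset.mem_range.1 hi
      obtain ⟨d, hd⟩ : ∃ d, d = j + 1 + i := ⟨_, rfl⟩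
      rw [show a + j + 1 + i = a + d by omega]
      exact hn.abs_cos_periodic (by omega) u
    have h := hn.sum_mul_abs_cos_le (j + t)
      (fun u => G u * ∏ i ∈ Finset.range t, |Real.cos (Real.pi * n u / 2 ^ (a + j + 1 + i))|)
      (fun u => mul_nonneg (hG u) (Finset.prod_nonneg fun _ _ => abs_nonneg _)) hper'
    rw [show j + 1 + (t + 1) = j + t + 2 by ring]
    rw [show j + 1 + t = j + t + 1 by ring] at ih
    calc ∑ u ∈ Finset.range (2 ^ (j + t + 2)),
          G u * ∏ i ∈ Finset.range (t + 1), |Real.cos (Real.pi * n u / 2 ^ (a + j + 1 + i))|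
        = ∑ u ∈ Finset.range (2 ^ (j + t + 2)),
          G u * (∏ i ∈ Finset.range t, |Real.cos (Real.pi * n u / 2 ^ (a + j + 1 + i))|)
            * |Real.cos (Real.pi * n u / 2 ^ (a + (j + t) + 1))| :=
          Finset.sum_congr rfl fun u _ => by
            rw [Finset.prod_range_succ, ← mul_assoc, show a + j + 1 + t = a + (j + t) + 1 by ring]
      _ ≤ _ := h
      _ ≤ √2 * (√2 ^ t * ∑ u ∈ Finset.range (2 ^ (j + 1)), G u) := by gcongr
      _ = _ := by ring

lemma ShiftFlips.blockFactor_periodic {n : ℕ → ℤ} {a : ℕ} (hn : ShiftFlips n a) (K : ℕ → ℕ)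
    (hK : Monotone K) (ε : ℕ → I) {l j : ℕ} (ha : a ≤ K l) (hj : K (l + 1) ≤ a + j) (u : ℕ) :
    blockFactor K ε (n (u + 2 ^ (j + 1))) l = blockFactor K ε (n u) l := by
  have := hK (Nat.le_succ l)
  unfold blockFactor
  congr 2
  refine Finset.prod_congr rfl fun i hi => ?_
  have hi := Finset.mem_range.1 hi
  obtain ⟨d, hd⟩ := Nat.exists_eq_add_of_le (show a ≤ K l + 1 + i by omega)
  rw [hd]
  exact hn.abs_cos_periodic (by omega) u

/-- Induction on blocks, with the earlier blocks as periodic weight. For a new block of length `d`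
the range grows by `2 ^ d`; the `δ(0)` part pays this in full and the cosine part only `√2 ^ d`. -/
lemma ShiftFlips.sum_prod_blockFactor_le {n : ℕ → ℤ} {a : ℕ} (hn : ShiftFlips n a) (K : ℕ → ℕ)
    (hK : Monotone K) (ε : ℕ → I) {M : ℕ} (ha : a ≤ K M) (t : ℕ) :
    ∑ u ∈ Finset.range (2 ^ (K (M + t) - a + 1)),
        ∏ l ∈ Finset.Ico M (M + t), blockFactor K ε (n u) l
      ≤ 2 ^ (K (M + t) - a + 1) * ∏ l ∈ Finset.Ico M (M + t),
        ((ε (l + 1) : ℝ) + (√2)⁻¹ ^ (K (l + 1) - K l)) := by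
  induction t with
  | zero => simp
  | succ t ih =>
    obtain ⟨j, hj⟩ := Nat.exists_eq_add_of_le (ha.trans (hK (Nat.le_add_right M t)))
    obtain ⟨d, hd⟩ := Nat.exists_eq_add_of_le (hK (Nat.le_succ (M + t)))
    have hKs : K (M + (t + 1)) = a + j + d := by rw [← hj]; exact hd
    have hKd : K (M + t + 1) - K (M + t) = d := by rw [Nat.succ_eq_add_one] at hd; omega
    set G : ℕ → ℝ := fun u => ∏ l ∈ Finset.Ico M (M + t), blockFactor K ε (n u) l with hGdef
    have hG : ∀ u, 0 ≤ G u := fun u => Finset.prod_nonneg fun _ _ => blockFactor_nonneg _ _ _ _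
    have hper : ∀ u, G (u + 2 ^ (j + 1)) = G u := fun u =>
      Finset.prod_congr rfl fun l hl => by
        rw [Finset.mem_Ico] at hl
        refine hn.blockFactor_periodic K hK ε (ha.trans (hK hl.1)) ?_ u
        rw [← hj]
        exact hK (by omega)
    have h1 := hn.sum_mul_prod_abs_cos_le j d G hG hper
    have h2 := sum_range_two_pow_of_periodic hper d
    have e1 : K (M + (t + 1)) - a + 1 = j + 1 + d := by omega
    have e2 : K (M + t) - a + 1 = j + 1 := by omega
    rw [e2] at ih
    have hs : (√2 : ℝ) ^ d = 2 ^ d * (√2)⁻¹ ^ d := by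
      rw [← mul_pow]
      congr 1
      field_simp
      norm_num
    have hε0 : (0 : ℝ) ≤ ε (M + t + 1) := (ε (M + t + 1)).2.1
    have hε1 : (0 : ℝ) ≤ 1 - ε (M + t + 1) := sub_nonneg.2 (ε (M + t + 1)).2.2
    have hS : 0 ≤ ∑ u ∈ Finset.range (2 ^ (j + 1)), G u := Finset.sum_nonneg fun u _ => hG u
    rw [e1, ← add_assoc, Finset.prod_Ico_succ_top (by omega), hKd]
    calc ∑ u ∈ Finset.range (2 ^ (j + 1 + d)),
          ∏ l ∈ Finset.Ico M (M + t + 1), blockFactor K ε (n u) l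
        = ε (M + t + 1) * ∑ u ∈ Finset.range (2 ^ (j + 1 + d)), G u
          + (1 - ε (M + t + 1)) * ∑ u ∈ Finset.range (2 ^ (j + 1 + d)), G u *
            ∏ i ∈ Finset.range d, |Real.cos (Real.pi * n u / 2 ^ (a + j + 1 + i))| := by
          rw [Finset.mul_sum, Finset.mul_sum, ← Finset.sum_add_distrib]
          refine Finset.sum_congr rfl fun u _ => ?_
          rw [Finset.prod_Ico_succ_top (by omega), blockFactor, hKd, hj]
          simp only [hGdef]
          ring
      _ ≤ ε (M + t + 1) * (2 ^ d * ∑ u ∈ Finset.range (2 ^ (j + 1)), G u)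
          + 1 * (√2 ^ d * ∑ u ∈ Finset.range (2 ^ (j + 1)), G u) := by
          rw [h2]
          have := mul_le_mul_of_nonneg_right (sub_le_self (1 : ℝ) hε0)
            (Finset.sum_nonneg fun u (_ : u ∈ Finset.range (2 ^ (j + 1 + d))) => mul_nonneg (hG u)
              (Finset.prod_nonneg fun i (_ : i ∈ Finset.range d) =>
                abs_nonneg (Real.cos (Real.pi * n u / 2 ^ (a + j + 1 + i)))))
          linarith
      _ = 2 ^ d * (ε (M + t + 1) + (√2)⁻¹ ^ d) * ∑ u ∈ Finset.range (2 ^ (j + 1)), G u := by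
          rw [hs]
          ring
      _ ≤ 2 ^ d * (ε (M + t + 1) + (√2)⁻¹ ^ d) * (2 ^ (j + 1) * ∏ l ∈ Finset.Ico M (M + t),
          ((ε (l + 1) : ℝ) + (√2)⁻¹ ^ (K (l + 1) - K l))) := by gcongr
      _ = _ := by
          rw [pow_add 2 (j + 1) d]
          ring

/-! ### The 2-adic structure of powers of an odd integer -/

lemma exists_two_pow_mul_odd {m : ℤ} (hm : m ≠ 0) : ∃ a : ℕ, ∃ q : ℤ, Odd q ∧ m = 2 ^ a * q := by
  obtain ⟨q, h, hq⟩ := ((Int.finiteMultiplicity_iff (a := 2) (b := m)).2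
    ⟨by norm_num, hm⟩).exists_eq_pow_mul_and_not_dvd
  exact ⟨_, q, by rwa [← Int.not_even_iff_odd, even_iff_two_dvd], h⟩

/-- An odd square is 1 modulo 4. Passing to `r ^ 2` secures `2 ≤ s` even when `r` is 3 modulo 4. -/
lemma exists_sq_eq_one_add_two_pow_mul_odd {r : ℤ} (hr : Odd r) (hr1 : 2 ≤ r) :
    ∃ s : ℕ, 2 ≤ s ∧ ∃ c : ℤ, Odd c ∧ r ^ 2 = 1 + 2 ^ s * c := by
  obtain ⟨s, c, hc, h⟩ := exists_two_pow_mul_odd (m := r ^ 2 - 1) (by nlinarith)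
  refine ⟨s, ?_, c, hc, by linarith⟩
  obtain ⟨k, rfl⟩ := hr
  obtain ⟨d, rfl⟩ := hc
  by_contra! hs
  interval_cases s
  · ring_nf at h
    omega
  · ring_nf at h
    omega

/-- Squaring: `(1 + 2 ^ m * c) ^ 2 = 1 + 2 ^ (m + 1) * (c + 2 ^ (m - 1) * c ^ 2)`, and the last
bracket stays odd because `m ≥ 2`. -/
lemma pow_two_pow_eq_one_add {r : ℤ} {s : ℕ} (hs : 2 ≤ s)
    (hr : ∃ c : ℤ, Odd c ∧ r ^ 2 = 1 + 2 ^ s * c) (j : ℕ) :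
    ∃ c : ℤ, Odd c ∧ r ^ 2 ^ (j + 1) = 1 + 2 ^ (s + j) * c := by
  induction j with
  | zero => simpa using hr
  | succ j ih =>
    obtain ⟨c, hc, h⟩ := ih
    obtain ⟨i, rfl⟩ := Nat.exists_eq_add_of_le hs
    refine ⟨c + 2 ^ (1 + i + j) * c ^ 2, hc.add_even ?_, ?_⟩
    · exact ((even_two.pow_of_ne_zero (by omega)).mul_right _)
    · rw [pow_succ 2 (j + 1), pow_mul, h]
      ring

lemma shiftFlips_geometric {r : ℤ} (hodd : Odd r) {s : ℕ} (hs : 2 ≤ s)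
    (hr : ∃ c : ℤ, Odd c ∧ r ^ 2 = 1 + 2 ^ s * c) (a : ℕ) {q : ℤ} (hq : Odd q) :
    ShiftFlips (fun u => 2 ^ a * q * r ^ u) (a + s) := by
  intro j u
  obtain ⟨c, hc, h⟩ := pow_two_pow_eq_one_add hs hr j
  refine ⟨q * r ^ u * c, (hq.mul hodd.pow).mul hc, ?_⟩
  simp only [pow_add r u, h]
  ring

/-- Multiplying by `x ^ 2 = 1 + 2 ^ t * (2 c + 2 ^ t c ^ 2)` changes `d` by an even number only. -/
lemma exists_one_add_pow_odd {x : ℤ} {t : ℕ} (ht : 1 ≤ t)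
    (hx : ∃ c : ℤ, Odd c ∧ x = 1 + 2 ^ t * c) {w : ℕ} (hw : Odd w) :
    ∃ d : ℤ, Odd d ∧ x ^ w = 1 + 2 ^ t * d := by
  obtain ⟨c, hc, rfl⟩ := hx
  obtain ⟨k, rfl⟩ := hw
  have he : Even ((2 : ℤ) ^ t) := even_two.pow_of_ne_zero (by omega)
  induction k with
  | zero => exact ⟨c, hc, by ring⟩
  | succ k ih =>
    obtain ⟨d, hd, h⟩ := ih
    refine ⟨d + (1 + 2 ^ t * d) * (2 * c + 2 ^ t * c ^ 2), hd.add_even ?_, ?_⟩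
    · exact ((even_two.mul_right c).add (he.mul_right _)).mul_left _
    · rw [show 2 * (k + 1) + 1 = 2 * k + 1 + 2 by ring, pow_add, h]
      ring

/-- With `v = 2 ^ b * w` and `w` odd, `r ^ v - 1` divides `r ^ (2 * v) - 1 = 2 ^ (s + b) * odd`,
which bounds its valuation by `s + b`. -/
lemma exists_pow_sub_one_eq {r : ℤ} (hr1 : 2 ≤ r) {s : ℕ} (hs : 2 ≤ s)
    (hr : ∃ c : ℤ, Odd c ∧ r ^ 2 = 1 + 2 ^ s * c) {v B : ℕ} (hv : ¬ 2 ^ B ∣ v) :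
    ∃ a : ℕ, ∃ q : ℤ, Odd q ∧ r ^ v - 1 = 2 ^ a * q ∧ a ≤ s + B := by
  have hv0 : v ≠ 0 := by rintro rfl; simp at hv
  obtain ⟨b, w, hw, rfl⟩ := Nat.exists_eq_two_pow_mul_odd hv0
  have hbB : b < B := by
    by_contra! h
    exact hv ((pow_dvd_pow 2 h).mul_right w)
  have h1 : 1 < r ^ (2 ^ b * w) := one_lt_pow₀ (by omega) hv0
  obtain ⟨a, q, hq, h⟩ := exists_two_pow_mul_odd (m := r ^ (2 ^ b * w) - 1) (by omega)
  refine ⟨a, q, hq, h, ?_⟩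
  obtain ⟨d, hd, h2⟩ := exists_one_add_pow_odd (by omega) (pow_two_pow_eq_one_add hs hr b) hw
  have h3 : (2 : ℤ) ^ a ∣ 2 ^ (s + b) * d := by
    refine ⟨q * (r ^ (2 ^ b * w) + 1), ?_⟩
    rw [← pow_mul] at h2
    have e : r ^ (2 ^ (b + 1) * w) = (r ^ (2 ^ b * w)) ^ 2 := by
      rw [← pow_mul]
      ring_nf
    rw [e] at h2
    linear_combination h * (r ^ (2 ^ b * w) + 1) - h2
  have h4 : (2 : ℤ) ^ a ∣ 2 ^ (s + b) := by
    refine IsCoprime.dvd_of_dvd_mul_right ?_ h3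
    exact IsCoprime.pow_left (Int.isCoprime_iff_gcd_eq_one.2 (by
      obtain ⟨k, rfl⟩ := hd
      rw [← Int.isCoprime_iff_gcd_eq_one]
      exact ⟨-k, 1, by ring⟩))
  have h5 : (2 : ℤ) ^ a ≤ 2 ^ (s + b) := Int.le_of_dvd (by positivity) h4
  have h6 := (pow_le_pow_iff_right₀ (by norm_num : (1 : ℤ) < 2)).1 h5
  omega

/-! ### Bounds for the double sums -/

/-- The bound for the product of the block factors with indices in `(M, L]`. -/
def blockProd (K : ℕ → ℕ) (ε : ℕ → I) (M L : ℕ) : ℝ :=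
  ∏ l ∈ Finset.Ico M L, ((ε (l + 1) : ℝ) + (√2)⁻¹ ^ (K (l + 1) - K l))

lemma blockProd_nonneg (K : ℕ → ℕ) (ε : ℕ → I) (M L : ℕ) : 0 ≤ blockProd K ε M L :=
  Finset.prod_nonneg fun l _ => add_nonneg (ε (l + 1)).2.1 (by positivity)

/-- The interval is covered by `N / T + 1` whole periods, of total length at most `2 N` because `T ≤
N`. -/
lemma sum_Icc_le_of_periodic {F : ℕ → ℝ} (hF : ∀ u, 0 ≤ F u) {T N : ℕ} (hT : 0 < T) (hTN : T ≤ N)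
    (hper : Function.Periodic F T) {B : ℝ} (hB : 0 ≤ B) (h : ∑ u ∈ Finset.range T, F u ≤ T * B) :
    ∑ u ∈ Finset.Icc 1 N, F u ≤ 2 * N * B := by
  have hmul (q : ℕ) : ∑ u ∈ Finset.range (T * q), F u = q * ∑ u ∈ Finset.range T, F u := by
    induction q with
    | zero => simp
    | succ q ih =>
      rw [mul_add, mul_one, Finset.sum_range_add, ih]
      have : ∀ u, F (T * q + u) = F u := fun u => by
        have := hper.nat_mul q u
        rw [← this]
        congr 1
        push_cast
        ring
      simp only [this]
      push_cast
      ring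
  have h1 : N < T * (N / T + 1) := Nat.lt_mul_div_succ N hT
  have h2 : T * (N / T + 1) ≤ 2 * N := by
    have := Nat.mul_div_le N T
    rw [mul_add]
    omega
  calc ∑ u ∈ Finset.Icc 1 N, F u ≤ ∑ u ∈ Finset.range (T * (N / T + 1)), F u := by
        refine Finset.sum_le_sum_of_subset_of_nonneg (fun u hu => ?_) fun u _ _ => hF u
        rw [Finset.mem_Icc] at hu
        rw [Finset.mem_range]
        omega
    _ = (N / T + 1 : ℕ) * ∑ u ∈ Finset.range T, F u := hmul _
    _ ≤ (N / T + 1 : ℕ) * (T * B) := by gcongr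
    _ = ((T * (N / T + 1) : ℕ) : ℝ) * B := by push_cast; ring
    _ ≤ ((2 * N : ℕ) : ℝ) * B := by gcongr
    _ = _ := by push_cast; ring

lemma sum_norm_fourierCoefficient_le (K : ℕ → ℕ) (hK : Monotone K) (ε : ℕ → I) {n : ℕ → ℤ} {a : ℕ}
    (hn : ShiftFlips n a) (ha1 : 1 ≤ a) {M L N : ℕ} (ha : a ≤ K M) (hML : M ≤ L)
    (hN : 2 ^ K L ≤ N) :
    ∑ u ∈ Finset.Icc 1 N, ‖fourierCoefficient (skewMeasure K ε) (n u)‖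
      ≤ 2 * N * blockProd K ε M L := by
  obtain ⟨t, rfl⟩ := Nat.exists_eq_add_of_le hML
  have haL : a ≤ K (M + t) := ha.trans (hK (Nat.le_add_right M t))
  refine (Finset.sum_le_sum fun u _ =>
    norm_fourierCoefficient_skewMeasure_le K hK ε (n u) M (M + t)).trans ?_
  refine sum_Icc_le_of_periodic (T := 2 ^ (K (M + t) - a + 1))
    (fun u => Finset.prod_nonneg fun _ _ => blockFactor_nonneg _ _ _ _) (by positivity)
    -- Here `1 ≤ a` absorbs the `+ 1` in the exponent of the period.
    ((Nat.pow_le_pow_right (by norm_num) (by omega)).trans hN) (fun u => ?_)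
    (blockProd_nonneg _ _ _ _) ?_
  · refine Finset.prod_congr rfl fun l hl => ?_
    rw [Finset.mem_Ico] at hl
    refine hn.blockFactor_periodic K hK ε (ha.trans (hK hl.1)) ?_ u
    rw [Nat.add_sub_cancel' haL]
    exact hK (by omega)
  · have := hn.sum_prod_blockFactor_le K hK ε ha t
    push_cast
    exact this

lemma card_filter_dvd_Icc_le (B N : ℕ) :
    (((Finset.Icc 1 N).filter (fun v => 2 ^ B ∣ v)).card : ℝ) ≤ N / 2 ^ B := by
  have h : (Finset.Icc 1 N).filter (fun v => 2 ^ B ∣ v)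
      = (Finset.Ioc 0 N).filter (fun v => 2 ^ B ∣ v) := by
    congr 1
  rw [h, Nat.Ioc_filter_dvd_card_eq_div]
  refine Nat.cast_div_le.trans ?_
  push_cast
  rfl

/-- The double sum is bounded by averaging over `u` when the 2-adic valuation of `v` is small. -/
lemma fourierDoubleSum_skewMeasure_le (K : ℕ → ℕ) (hK : Monotone K) (ε : ℕ → I) {r : ℕ}
    (hr : r ∈ oddBases) {h : ℤ} (hh : h ≠ 0) :
    ∃ C : ℕ, ∀ M L N B : ℕ, B + C ≤ K M → M ≤ L → 2 ^ K L ≤ N →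
      fourierDoubleSum (skewMeasure K ε) h r N
        ≤ (2 * blockProd K ε M L + 1 / 2 ^ B) * (N : ℝ) ^ 2 := by
  obtain ⟨hr2, hodd⟩ := hr
  have hoddZ : Odd (r : ℤ) := by exact_mod_cast hodd
  have hr2Z : (2 : ℤ) ≤ r := by exact_mod_cast hr2
  obtain ⟨s, hs, hc⟩ := exists_sq_eq_one_add_two_pow_mul_odd hoddZ hr2Z
  obtain ⟨e, p, hp, rfl⟩ := exists_two_pow_mul_odd hh
  -- One `s` comes from the valuation of `r ^ v - 1`, at most `s + B`, the other from the start `a +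
  -- s` of the flipping digits; `e` is the valuation of `h`.
  refine ⟨e + s + s, fun M L N B hB hML hN => ?_⟩
  unfold fourierDoubleSum
  rw [← Finset.sum_filter_not_add_sum_filter (Finset.Icc 1 N) (fun v => 2 ^ B ∣ v)]
  have hgood : ∀ v ∈ (Finset.Icc 1 N).filter (fun v => ¬ 2 ^ B ∣ v),
      ∑ u ∈ Finset.Icc 1 N, ‖fourierCoefficient (skewMeasure K ε)
        (2 ^ e * p * (r : ℤ) ^ u * ((r : ℤ) ^ v - 1))‖ ≤ 2 * N * blockProd K ε M L := by
    intro v hv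
    obtain ⟨a, q, hq, hv', ha⟩ := exists_pow_sub_one_eq hr2Z hs hc (Finset.mem_filter.1 hv).2
    have := sum_norm_fourierCoefficient_le K hK ε
      (shiftFlips_geometric hoddZ hs hc (e + a) (hp.mul hq)) (by omega) (M := M) (L := L) (N := N)
      (by omega) hML hN
    refine le_of_eq_of_le (Finset.sum_congr rfl fun u _ => ?_) this
    rw [hv']
    congr 2
    ring
  have hbad : ∀ v ∈ (Finset.Icc 1 N).filter (fun v => 2 ^ B ∣ v),
      ∑ u ∈ Finset.Icc 1 N, ‖fourierCoefficient (skewMeasure K ε)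
        (2 ^ e * p * (r : ℤ) ^ u * ((r : ℤ) ^ v - 1))‖ ≤ N := by
    intro v _
    refine (Finset.sum_le_sum fun u _ => norm_fourierCoefficient_le_one _ _).trans ?_
    simp
  have h1 := Finset.sum_le_card_nsmul _ _ _ hgood
  have h2 := Finset.sum_le_card_nsmul _ _ _ hbad
  have h3 : (((Finset.Icc 1 N).filter (fun v => ¬ 2 ^ B ∣ v)).card : ℝ) ≤ N := by
    refine (Nat.cast_le.2 (Finset.card_filter_le _ _)).trans ?_
    simp
  have h4 := card_filter_dvd_Icc_le B N
  rw [nsmul_eq_mul] at h1 h2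
  have h5 := mul_le_mul_of_nonneg_right h3
    (show 0 ≤ 2 * N * blockProd K ε M L from mul_nonneg (by positivity) (blockProd_nonneg _ _ _ _))
  have h6 := mul_le_mul_of_nonneg_right h4 (Nat.cast_nonneg (α := ℝ) N)
  refine (add_le_add (h1.trans h5) (h2.trans h6)).trans (le_of_eq ?_)
  ring

/-! ### Growth of the parameters -/

lemma floor_sqrt_log_mono {l m : ℕ} (hl : 1 ≤ l) (h : l ≤ m) :
    ⌊√(Real.log (l : ℝ))⌋₊ ≤ ⌊√(Real.log (m : ℝ))⌋₊ := by
  have hl' : (0 : ℝ) < l := by exact_mod_cast hl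
  gcongr

lemma one_le_floor_sqrt_log {l : ℕ} (hl : 3 ≤ l) : 1 ≤ ⌊√(Real.log (l : ℝ))⌋₊ := by
  have hl' : (3 : ℝ) ≤ l := by exact_mod_cast hl
  rw [Nat.one_le_floor_iff, Real.one_le_sqrt, Real.le_log_iff_exp_le (by linarith)]
  linarith [Real.exp_one_lt_d9]

lemma specialK_monotone {K : ℕ} (hK : 1 ≤ K) : Monotone (specialK K) := by
  intro l m h
  unfold specialK
  rcases Nat.eq_zero_or_pos l with rfl | hl
  · simp
  · rw [if_neg hl.ne', if_neg (hl.trans_le h).ne']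
    exact Nat.pow_le_pow_right hK (Nat.mul_le_mul h (floor_sqrt_log_mono hl h))

lemma pow_le_specialK {K l : ℕ} (hK : 1 ≤ K) (hl : 3 ≤ l) : K ^ l ≤ specialK K l := by
  rw [specialK, if_neg (by omega)]
  exact Nat.pow_le_pow_right hK (Nat.le_mul_of_pos_right l (one_le_floor_sqrt_log hl))

lemma mul_specialK_le {K l : ℕ} (hK : 1 ≤ K) (hl : 3 ≤ l) :
    K * specialK K l ≤ specialK K (l + 1) := by
  rw [specialK, specialK, if_neg (by omega), if_neg (by omega), ← pow_succ']
  refine Nat.pow_le_pow_right hK ?_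
  have h1 := floor_sqrt_log_mono (show 1 ≤ l by omega) (Nat.le_succ l)
  have h2 := one_le_floor_sqrt_log hl
  calc _ ≤ l * ⌊√(Real.log (l : ℝ))⌋₊ + ⌊√(Real.log (l : ℝ))⌋₊ := by omega
    _ = (l + 1) * ⌊√(Real.log (l : ℝ))⌋₊ := by ring
    _ ≤ _ := Nat.mul_le_mul_left _ h1

/-- In logarithms, with `t = √(log x)`: a linear function of `t` is eventually below `t ^ 2`. -/
lemma eventually_mul_pow_floor_sqrt_log_le (K : ℕ) (hK : 1 ≤ K) :
    ∀ᶠ x : ℕ in atTop, 8 * (K : ℝ) ^ (8 * ⌊√(Real.log (x : ℝ))⌋₊) ≤ x := by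
  have ht : Tendsto (fun x : ℕ => √(Real.log (x : ℝ))) atTop atTop :=
    Real.tendsto_sqrt_atTop.comp (Real.tendsto_log_atTop.comp tendsto_natCast_atTop_atTop)
  filter_upwards [ht.eventually_ge_atTop (8 * Real.log K + Real.log 8 + 1),
    eventually_ge_atTop 1] with x hx hx1
  have hK' : (1 : ℝ) ≤ K := by exact_mod_cast hK
  have hx' : (1 : ℝ) ≤ x := by exact_mod_cast hx1
  have hlogK := Real.log_nonneg hK'
  have hlog8 := Real.log_nonneg (by norm_num : (1 : ℝ) ≤ 8)
  have hfl := Nat.floor_le (Real.sqrt_nonneg (Real.log (x : ℝ)))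
  have hsq := Real.sq_sqrt (Real.log_nonneg hx')
  rw [← Real.log_le_log_iff (by positivity) (by positivity),
    Real.log_mul (by norm_num) (by positivity), Real.log_pow]
  push_cast
  set t := √(Real.log (x : ℝ))
  have h1 : 8 * (⌊t⌋₊ : ℝ) * Real.log K ≤ 8 * t * Real.log K := by gcongr
  nlinarith

lemma mul_succ_le_ten_pow (n : ℕ) : n * (n + 1) ≤ 10 ^ n ∧ n + 1 ≤ 10 ^ n := by
  induction n with
  | zero => simp
  | succ n ih =>
    rw [pow_succ]
    constructor <;> nlinarith [ih.1, ih.2]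

/-- Blocks this long make `2 ^ (-d / 2)` no larger than `ε_{l+1} = 1 / (l + 1)`. -/
lemma two_mul_succ_le_sub_specialK {K l : ℕ} (hK : 10 ≤ K) (hl : 3 ≤ l) :
    2 * (l + 1) ≤ specialK K (l + 1) - specialK K l := by
  have h1 := mul_specialK_le (by omega : 1 ≤ K) hl
  have h2 := pow_le_specialK (by omega : 1 ≤ K) hl
  have h3 : 10 ^ l ≤ K ^ l := Nat.pow_le_pow_left hK l
  have h4 := (mul_succ_le_ten_pow l).2
  have h5 : 10 * specialK K l ≤ K * specialK K l := Nat.mul_le_mul_right _ hK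
  omega

lemma inv_sqrt_two_pow_le {l d : ℕ} (h : 2 * l ≤ d) (hl : 1 ≤ l) :
    (√2)⁻¹ ^ d ≤ 1 / (l : ℝ) := by
  have h1 : (√2)⁻¹ ≤ 1 := inv_le_one_of_one_le₀ (by
    rw [Real.one_le_sqrt]
    norm_num)
  have hl' : (0 : ℝ) < l := by exact_mod_cast hl
  refine (pow_le_pow_of_le_one (by positivity) h1 h).trans ?_
  rw [pow_mul, inv_pow, Real.sq_sqrt (by norm_num), inv_pow, ← one_div]
  refine one_div_le_one_div_of_le hl' ?_
  exact_mod_cast Nat.lt_two_pow_self.le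

/-- The assumptions on `κ` and `ε` shared by the two parameter choices. -/
structure IsSpecialChoice (K : ℕ) (κ : ℕ → ℕ) (ε : ℕ → I) : Prop where
  mono : Monotone κ
  zero : κ 0 = 0
  one : κ 1 = 1
  eq_specialK : ∀ l, 3 ≤ l → κ l = specialK K l
  eq_specialEps : ∀ l, 1 ≤ l → ε l = specialEps l

lemma IsSpecialChoice.blockProd_le {K : ℕ} (hK : 10 ≤ K) {κ : ℕ → ℕ} {ε : ℕ → I}
    (hκ : IsSpecialChoice K κ ε) {M L : ℕ} (hM : 3 ≤ M) :
    blockProd κ ε M L ≤ (2 / (M : ℝ)) ^ (L - M) := by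
  rw [← Nat.card_Ico, ← Finset.prod_const]
  refine Finset.prod_le_prod (fun l _ => add_nonneg (ε (l + 1)).2.1 (by positivity)) fun l hl => ?_
  have hl := (Finset.mem_Ico.1 hl).1
  have h1 : (√2)⁻¹ ^ (κ (l + 1) - κ l) ≤ 1 / ((l + 1 : ℕ) : ℝ) := by
    rw [hκ.eq_specialK _ (by omega), hκ.eq_specialK _ (by omega)]
    exact inv_sqrt_two_pow_le (two_mul_succ_le_sub_specialK hK (by omega)) (by omega)
  have h2 : (ε (l + 1) : ℝ) = 1 / ((l + 1 : ℕ) : ℝ) := by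
    rw [hκ.eq_specialEps _ (by omega)]
    rfl
  have hM' : (0 : ℝ) < M := by exact_mod_cast (by omega : 0 < M)
  have h3 : 1 / ((l + 1 : ℕ) : ℝ) ≤ 1 / (M : ℝ) :=
    one_div_le_one_div_of_le hM' (by exact_mod_cast (by omega : M ≤ l + 1))
  calc _ ≤ 1 / (M : ℝ) + 1 / (M : ℝ) := by rw [h2]; exact add_le_add h3 (h1.trans h3)
    _ = _ := by ring

/-- Put `M = L / 2` and `lam = ⌊√(log (L + 1))⌋`. The left side is `K ^ (2 (L + 1) lam)`, at most
`(K ^ (8 lam)) ^ (L - M)` since `L + 1 ≤ 4 (L - M)`, and `K ^ (8 lam) ≤ M / 2` by the slow growth of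
`lam`. The second bound follows from `(M / 2) ^ (L - M) ≤ 2 ^ (M (M + 1))` and `M (M + 1) ≤ 10 ^ M ≤
κ M`. -/
lemma IsSpecialChoice.eventually_sq_le {K : ℕ} (hK : 10 ≤ K) {κ : ℕ → ℕ} {ε : ℕ → I}
    (hκ : IsSpecialChoice K κ ε) :
    ∀ᶠ L : ℕ in atTop, (κ (L + 1) : ℝ) ^ 2 ≤ ((L / 2 : ℕ) / 2 : ℝ) ^ (L - L / 2) ∧
      (κ (L + 1) : ℝ) ^ 2 ≤ 2 ^ κ (L / 2) := by
  have h := (tendsto_add_atTop_nat 1).eventually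
    (eventually_mul_pow_floor_sqrt_log_le K (by omega))
  filter_upwards [h, eventually_ge_atTop 6] with L hL hL6
  obtain ⟨M, hM⟩ : ∃ M, M = L / 2 := ⟨_, rfl⟩
  rw [← hM]
  set lam := ⌊√(Real.log ((L + 1 : ℕ) : ℝ))⌋₊ with hlam
  have hK1 : (1 : ℝ) ≤ K := by exact_mod_cast (by omega : 1 ≤ K)
  have hML : ((L + 1 : ℕ) : ℝ) ≤ 4 * M := by exact_mod_cast (by omega : L + 1 ≤ 4 * M)
  have h1 : (K : ℝ) ^ (8 * lam) ≤ M / 2 := by linarith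
  have h2 : (κ (L + 1) : ℝ) ^ 2 ≤ (M / 2 : ℝ) ^ (L - M) := by
    rw [hκ.eq_specialK _ (by omega), specialK, if_neg (by omega), ← hlam]
    push_cast
    calc ((K : ℝ) ^ ((L + 1) * lam)) ^ 2 = (K : ℝ) ^ (lam * (2 * (L + 1))) := by
          rw [← pow_mul]; congr 1; ring
      _ ≤ (K : ℝ) ^ (lam * (8 * (L - M))) := by
          refine pow_le_pow_right₀ hK1 (Nat.mul_le_mul_left _ ?_)
          omega
      _ = ((K : ℝ) ^ (8 * lam)) ^ (L - M) := by rw [← pow_mul]; congr 1; ring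
      _ ≤ _ := by gcongr
  refine ⟨h2, h2.trans ?_⟩
  have h3 : (M / 2 : ℝ) ≤ 2 ^ M := by
    have : (M : ℝ) ≤ 2 ^ M := by exact_mod_cast Nat.lt_two_pow_self.le
    linarith [(Nat.cast_nonneg M : (0 : ℝ) ≤ M)]
  have h4 : M * (M + 1) ≤ κ M := by
    rw [hκ.eq_specialK _ (by omega)]
    exact (mul_succ_le_ten_pow M).1.trans
      ((Nat.pow_le_pow_left hK M).trans (pow_le_specialK (by omega) (by omega)))
  calc (M / 2 : ℝ) ^ (L - M) ≤ (2 ^ M) ^ (L - M) := by gcongr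
    _ = 2 ^ (M * (L - M)) := by rw [← pow_mul]
    _ ≤ 2 ^ κ M := by
        refine pow_le_pow_right₀ (by norm_num) (le_trans (Nat.mul_le_mul_left _ ?_) h4)
        omega

/-- Cauchy condensation reduces this to `∑ 1 / (m + 1) ^ 2`. -/
lemma summable_inv_mul_sq_log :
    Summable (fun N : ℕ => ((N : ℝ) * ((Nat.log 2 N : ℝ) + 1) ^ 2)⁻¹) := by
  rw [← summable_condensed_iff_of_nonneg (fun n => by positivity)]
  · have h := (summable_nat_add_iff 1).2 (Real.summable_nat_pow_inv.2 (by norm_num : 1 < 2))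
    refine h.congr fun m => ?_
    rw [Nat.log_pow (by norm_num)]
    push_cast
    field_simp
  · intro m n hm hmn
    have hm' : (0 : ℝ) < m := by exact_mod_cast hm
    have := Nat.log_mono_right (b := 2) hmn
    gcongr

/-- The first half of `HasOddBaseProperty`. -/
theorem IsSpecialChoice.summable_fourierDoubleSum {K : ℕ} (hK : 10 ≤ K) {κ : ℕ → ℕ} {ε : ℕ → I}
    (hκ : IsSpecialChoice K κ ε) {r : ℕ} (hr : r ∈ oddBases) {h : ℤ} (hh : h ≠ 0) :
    Summable (fun N : ℕ => fourierDoubleSum (skewMeasure κ ε) h r N / (N : ℝ) ^ 3) := by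
  obtain ⟨C, hC⟩ := fourierDoubleSum_skewMeasure_le κ hκ.mono ε hr hh
  obtain ⟨L₀, hL₀⟩ := eventually_atTop.1 (hκ.eventually_sq_le hK)
  have hid (l : ℕ) (hl : 3 ≤ l) : l ≤ κ l := by
    rw [hκ.eq_specialK l hl]
    exact (Nat.lt_pow_self (by omega : 1 < K)).le.trans (pow_le_specialK (by omega) hl)
  refine Summable.of_norm_bounded_eventually_nat
    (summable_inv_mul_sq_log.mul_left (2 + 2 ^ C : ℝ)) ?_
  filter_upwards [eventually_ge_atTop (2 ^ κ (L₀ + 2 * C + 6))] with N hN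
  have hN1 : 1 ≤ N := Nat.one_le_two_pow.trans hN
  -- The first such index is `L + 1`, so that `2 ^ κ L ≤ N < 2 ^ κ (L + 1)` and `log N` is
  -- controlled by `κ (L + 1)`.
  have hex : ∃ l, N < 2 ^ κ l :=
    ⟨N + 3, Nat.lt_two_pow_self.trans_le
      (Nat.pow_le_pow_right (by norm_num) ((Nat.le_add_right N 3).trans (hid _ (by omega))))⟩
  obtain ⟨L, hL⟩ : ∃ L, Nat.find hex = L + 1 := Nat.exists_eq_succ_of_ne_zero fun h0 => by
    have := Nat.find_spec hex
    rw [h0, hκ.zero] at this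
    omega
  have hlt : N < 2 ^ κ (L + 1) := hL ▸ Nat.find_spec hex
  have hle : 2 ^ κ L ≤ N := not_lt.1 (Nat.find_min hex (by omega))
  have hLL : L₀ + 2 * C + 6 ≤ L := by
    by_contra! hcon
    exact absurd (hN.trans_lt hlt) (not_lt.2 (Nat.pow_le_pow_right (by norm_num)
      (hκ.mono (by omega))))
  obtain ⟨hA, hB⟩ := hL₀ L (by omega)
  -- Halving leaves enough blocks above `M` while the exceptional `v`, of proportion at most `2 ^ (C
  -- - κ M)`, remain negligible.
  obtain ⟨M, hM⟩ : ∃ M, M = L / 2 := ⟨_, rfl⟩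
  rw [← hM] at hA hB
  have hCM : C ≤ κ M := (by omega : C ≤ M).trans (hid M (by omega))
  have hbound := hC M L N (κ M - C) (by omega) (by omega) hle
  have hκpos : (0 : ℝ) < κ (L + 1) := by
    exact_mod_cast (Nat.succ_pos L).trans_le (hid (L + 1) (by omega))
  have hlog : (Nat.log 2 N : ℝ) + 1 ≤ κ (L + 1) := by
    exact_mod_cast Nat.log_lt_of_lt_pow (by omega) hlt
  have e1 : 2 * blockProd κ ε M L + 1 / 2 ^ (κ M - C) ≤ (2 + 2 ^ C) * ((κ (L + 1) : ℝ) ^ 2)⁻¹ := by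
    have b1 : blockProd κ ε M L ≤ ((κ (L + 1) : ℝ) ^ 2)⁻¹ := by
      refine (hκ.blockProd_le hK (by omega)).trans ?_
      rw [← inv_div, inv_pow]
      exact inv_anti₀ (by positivity) hA
    have b2 : (1 : ℝ) / 2 ^ (κ M - C) ≤ 2 ^ C * ((κ (L + 1) : ℝ) ^ 2)⁻¹ := by
      obtain ⟨d, hd⟩ := Nat.exists_eq_add_of_le hCM
      have : (1 : ℝ) / 2 ^ (κ M - C) = 2 ^ C * (2 ^ κ M)⁻¹ := by
        rw [hd, Nat.add_sub_cancel_left, pow_add]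
        field_simp
      rw [this]
      gcongr
    linarith
  have e2 : ((κ (L + 1) : ℝ) ^ 2)⁻¹ ≤ (((Nat.log 2 N : ℝ) + 1) ^ 2)⁻¹ := by gcongr
  have hNpos : (0 : ℝ) < N := by exact_mod_cast hN1
  have hnonneg : 0 ≤ fourierDoubleSum (skewMeasure κ ε) h r N :=
    Finset.sum_nonneg fun _ _ => Finset.sum_nonneg fun _ _ => norm_nonneg _
  rw [Real.norm_of_nonneg (by positivity), div_le_iff₀ (by positivity)]
  calc _ ≤ _ := hbound
    _ ≤ ((2 + 2 ^ C) * (((Nat.log 2 N : ℝ) + 1) ^ 2)⁻¹) * (N : ℝ) ^ 2 := by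
        refine mul_le_mul_of_nonneg_right (e1.trans ?_) (by positivity)
        gcongr
    _ = _ := by
        field_simp

/-! ### The criterion of Davenport, Erdős and LeVeque -/

/-- Partial sums move by at most 1 per step. If `‖S N‖ ≥ c N`, then `‖S m‖ ≥ c N / 2` for all `m` in
a window of length about `c N / 2` after `N`, whose terms have a sum bounded below; this contradicts
the Cauchy criterion. -/
lemma tendsto_average_zero_of_summable {a : ℕ → ℂ} (ha : ∀ n, ‖a n‖ ≤ 1)
    (hs : Summable fun N : ℕ => ‖∑ n ∈ Finset.Icc 1 N, a n‖ ^ 2 / (N : ℝ) ^ 3) :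
    Tendsto (fun N : ℕ => (∑ n ∈ Finset.range N, a n) / (N : ℂ)) atTop (𝓝 0) := by
  set S : ℕ → ℂ := fun N => ∑ n ∈ Finset.Icc 1 N, a n with hS
  have hstep (N d : ℕ) : ‖S N‖ ≤ ‖S (N + d)‖ + d := by
    induction d with
    | zero => simp
    | succ d ih =>
      have e : S (N + d) = S (N + (d + 1)) - a (N + d + 1) := by
        simp only [hS]
        rw [← add_assoc, Finset.sum_Icc_succ_top (by omega)]
        ring
      have h2 : ‖S (N + d)‖ ≤ ‖S (N + (d + 1))‖ + 1 := by
        rw [e]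
        exact (norm_sub_le _ _).trans (by linarith [ha (N + d + 1)])
      push_cast
      linarith
  have key : Tendsto (fun N : ℕ => ‖S N‖ / (N : ℝ)) atTop (𝓝 0) := by
    rw [Metric.tendsto_atTop]
    by_contra! hcon
    obtain ⟨c₀, hc₀, hfreq₀⟩ := hcon
    obtain ⟨c, hc, hc1, hcc⟩ : ∃ c : ℝ, 0 < c ∧ c ≤ 1 ∧ c ≤ c₀ :=
      ⟨min c₀ 1, lt_min hc₀ one_pos, min_le_right _ _, min_le_left _ _⟩
    -- The threshold is `(c N / 2) * ((c N / 2) ^ 2 / (2 N) ^ 3)`: window length times a lower bound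
    -- for a term, with `m ≤ 2 N` because `c ≤ 1`.
    obtain ⟨s, hsv⟩ := summable_iff_vanishing_norm.1 hs (c ^ 3 / 64) (by positivity)
    obtain ⟨N, hN, hdist⟩ := hfreq₀ (s.sup id + 1)
    have hN0 : (0 : ℝ) < N := by exact_mod_cast (by omega : 0 < N)
    have hSN : c * N ≤ ‖S N‖ := by
      rw [Real.dist_eq, sub_zero, abs_of_nonneg (by positivity), le_div_iff₀ hN0] at hdist
      exact (mul_le_mul_of_nonneg_right hcc hN0.le).trans hdist
    set D := ⌊c * N / 2⌋₊ with hD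
    have hD1 : (D : ℝ) ≤ c * N / 2 := Nat.floor_le (by positivity)
    have hD2 : c * N / 2 < D + 1 := Nat.lt_floor_add_one _
    have hdisj : Disjoint (Finset.Icc N (N + D)) s := by
      rw [Finset.disjoint_left]
      intro x hx hxs
      have h1 : x ≤ s.sup id := Finset.le_sup (f := id) hxs
      have := (Finset.mem_Icc.1 hx).1
      omega
    have hlow : ∀ m ∈ Finset.Icc N (N + D), c ^ 2 / (32 * N) ≤ ‖S m‖ ^ 2 / (m : ℝ) ^ 3 := by
      intro m hm
      rw [Finset.mem_Icc] at hm
      obtain ⟨d, rfl⟩ := Nat.exists_eq_add_of_le hm.1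
      have hdD : (d : ℝ) ≤ D := by exact_mod_cast (by omega : d ≤ D)
      have h1 : c * N / 2 ≤ ‖S (N + d)‖ := by linarith [hstep N d]
      have h2 : ((N + d : ℕ) : ℝ) ≤ 2 * N := by
        push_cast
        nlinarith
      have h3 : (0 : ℝ) < ((N + d : ℕ) : ℝ) := by
        push_cast
        positivity
      calc c ^ 2 / (32 * N) = (c * N / 2) ^ 2 / (2 * N) ^ 3 := by
            field_simp
            norm_num
        _ ≤ ‖S (N + d)‖ ^ 2 / (2 * N) ^ 3 := by gcongr
        _ ≤ _ := by gcongr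
    have hsum := Finset.card_nsmul_le_sum _ _ _ hlow
    rw [Nat.card_Icc, nsmul_eq_mul, show N + D + 1 - N = D + 1 by omega] at hsum
    have h1 := hsv _ hdisj
    rw [Real.norm_of_nonneg (Finset.sum_nonneg fun _ _ => by positivity)] at h1
    have h2 : c ^ 3 / 64 ≤ ((D + 1 : ℕ) : ℝ) * (c ^ 2 / (32 * N)) := by
      push_cast
      calc c ^ 3 / 64 = (c * N / 2) * (c ^ 2 / (32 * N)) := by
            field_simp
            norm_num
        _ ≤ _ := by gcongr
    linarith
  have h2 : Tendsto (fun N : ℕ => 2 / (N : ℝ)) atTop (𝓝 0) :=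
    tendsto_const_div_atTop_nhds_zero_nat 2
  have h3 := key.add h2
  rw [add_zero] at h3
  refine squeeze_zero_norm (fun N => ?_) h3
  have e : ∑ n ∈ Finset.range N, a n = S N + a 0 - a N := by
    have h4 : ∑ n ∈ Finset.range (N + 1), a n = S N + a 0 := by
      rw [Finset.sum_range_succ', hS]
      congr 1
      rw [Finset.range_eq_Ico, Finset.sum_Ico_add' a 0 N 1]
      rfl
    rw [← h4, Finset.sum_range_succ, add_sub_cancel_right]
  rw [norm_div, Complex.norm_natCast, e, ← add_div]
  gcongr
  calc ‖S N + a 0 - a N‖ ≤ ‖S N + a 0‖ + ‖a N‖ := norm_sub_le _ _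
    _ ≤ ‖S N‖ + ‖a 0‖ + ‖a N‖ := by gcongr; exact norm_add_le _ _
    _ ≤ _ := by linarith [ha 0, ha N]

/-- The character `x ↦ e(n x)`. -/
def expChar (n : ℤ) (x : ℝ) : ℂ :=
  Complex.exp (2 * (Real.pi : ℂ) * Complex.I * ((n : ℂ) * (x : ℂ)))

lemma norm_expChar (n : ℤ) (x : ℝ) : ‖expChar n x‖ = 1 := by
  rw [expChar, show 2 * (Real.pi : ℂ) * Complex.I * ((n : ℂ) * (x : ℂ))
    = ((2 * Real.pi * n * x : ℝ) : ℂ) * Complex.I by push_cast; ring,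
    Complex.norm_exp_ofReal_mul_I]

lemma continuous_expChar (n : ℤ) : Continuous (expChar n) := by
  unfold expChar
  fun_prop

lemma expChar_mul_conj (m n : ℤ) (x : ℝ) :
    expChar m x * (starRingEnd ℂ) (expChar n x) = expChar (m - n) x := by
  unfold expChar
  rw [← Complex.exp_conj, ← Complex.exp_add]
  congr 1
  have h2 : (starRingEnd ℂ) 2 = 2 := Complex.conj_ofNat 2
  simp [h2]
  ring

lemma integrable_expChar (μ : Measure ℝ) [IsProbabilityMeasure μ] (n : ℤ) :
    Integrable (expChar n) μ :=
  (integrable_const (1 : ℝ)).mono' (continuous_expChar n).aestronglyMeasurable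
    (Eventually.of_forall fun x => (norm_expChar n x).le)

lemma sq_norm_sum_expChar (s : Finset ℕ) (f : ℕ → ℤ) (x : ℝ) :
    ((‖∑ n ∈ s, expChar (f n) x‖ ^ 2 : ℝ) : ℂ)
      = ∑ m ∈ s, ∑ n ∈ s, expChar (f m - f n) x := by
  rw [Complex.ofReal_pow, ← Complex.mul_conj', map_sum, Finset.sum_mul_sum]
  simp only [expChar_mul_conj]

lemma integral_sq_norm_sum_expChar_le (μ : Measure ℝ) [IsProbabilityMeasure μ] (s : Finset ℕ)
    (f : ℕ → ℤ) :
    ∫ x, ‖∑ n ∈ s, expChar (f n) x‖ ^ 2 ∂μ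
      ≤ ∑ m ∈ s, ∑ n ∈ s, ‖fourierCoefficient μ (f m - f n)‖ := by
  have h0 : 0 ≤ ∫ x, ‖∑ n ∈ s, expChar (f n) x‖ ^ 2 ∂μ := integral_nonneg fun x => by positivity
  have h1 : ((∫ x, ‖∑ n ∈ s, expChar (f n) x‖ ^ 2 ∂μ : ℝ) : ℂ)
      = ∑ m ∈ s, ∑ n ∈ s, fourierCoefficient μ (f m - f n) := by
    rw [← integral_complex_ofReal]
    simp only [sq_norm_sum_expChar]
    rw [integral_finsetSum _ fun m _ => integrable_finsetSum _ fun n _ => integrable_expChar μ _]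
    refine Finset.sum_congr rfl fun m _ => ?_
    rw [integral_finsetSum _ fun n _ => integrable_expChar μ _]
    rfl
  rw [← Real.norm_of_nonneg h0, ← Complex.norm_real, h1]
  exact (norm_sum_le _ _).trans (Finset.sum_le_sum fun m _ => norm_sum_le _ _)

/-- The diagonal gives at most `N`. The two off-diagonal halves agree by conjugation, and for `m <
n` the frequency is `h r^m (r^(n - m) - 1)`, so `u = m`, `v = n - m`. -/
lemma sum_norm_fourierCoefficient_sub_le (μ : Measure ℝ) [IsProbabilityMeasure μ] (h : ℤ)
    (r N : ℕ) :
    ∑ m ∈ Finset.Icc 1 N, ∑ n ∈ Finset.Icc 1 N,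
        ‖fourierCoefficient μ (h * (r : ℤ) ^ m - h * (r : ℤ) ^ n)‖
      ≤ N + 2 * fourierDoubleSum μ h r N := by
  set c : ℤ → ℝ := fun k => ‖fourierCoefficient μ k‖ with hc
  set F : ℕ → ℕ → ℝ := fun m n => c (h * (r : ℤ) ^ m - h * (r : ℤ) ^ n) with hF
  have hsymm (m n : ℕ) : F m n = F n m := by
    simp only [hF, hc]
    rw [← norm_fourierCoefficient_neg, neg_sub]
  have hF0 (m n : ℕ) : 0 ≤ F m n := norm_nonneg _
  have hF1 (m n : ℕ) : F m n ≤ 1 := norm_fourierCoefficient_le_one μ _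
  set U : ℝ := ∑ m ∈ Finset.Icc 1 N, ∑ n ∈ Finset.Icc 1 N, if m < n then F n m else 0 with hU
  have hsplit (m n : ℕ) : F m n = (if m = n then F m n else 0) + (if m < n then F n m else 0)
      + (if n < m then F m n else 0) := by
    rcases lt_trichotomy m n with hmn | rfl | hmn
    · simp [hmn, hmn.ne, hmn.le.not_gt, hsymm m n]
    · simp
    · simp [hmn, hmn.ne', hmn.le.not_gt]
  have hdiag : ∑ m ∈ Finset.Icc 1 N, ∑ n ∈ Finset.Icc 1 N, (if m = n then F m n else 0)
      ≤ (N : ℝ) := by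
    calc _ ≤ ∑ m ∈ Finset.Icc 1 N, (1 : ℝ) := by
          refine Finset.sum_le_sum fun m hm => ?_
          rw [Finset.sum_ite_eq, if_pos hm]
          exact hF1 m m
      _ = N := by simp
  have hUle : U ≤ fourierDoubleSum μ h r N := by
    rw [fourierDoubleSum, Finset.sum_comm]
    refine Finset.sum_le_sum fun m _ => ?_
    rw [← Finset.sum_filter]
    refine le_trans (le_of_eq ?_) (Finset.sum_le_sum_of_subset_of_nonneg
      (s := ((Finset.Icc 1 N).filter (m < ·)).image (· - m)) ?_ fun _ _ _ => norm_nonneg _)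
    · rw [Finset.sum_image]
      · refine Finset.sum_congr rfl fun n hn => ?_
        have hmn := (Finset.mem_filter.1 hn).2
        obtain ⟨d, rfl⟩ := Nat.exists_eq_add_of_lt hmn
        simp only [hF, hc]
        congr 2
        rw [show m + d + 1 - m = d + 1 by omega]
        ring
      · intro a ha b hb hab
        have h1 := (Finset.mem_filter.1 ha).2
        have h2 := (Finset.mem_filter.1 hb).2
        simp only at hab
        omega
    · intro v hv
      obtain ⟨n, hn, rfl⟩ := Finset.mem_image.1 hv
      have h1 := Finset.mem_filter.1 hn
      have h2 := Finset.mem_Icc.1 h1.1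
      rw [Finset.mem_Icc]
      omega
  have hU2 : ∑ m ∈ Finset.Icc 1 N, ∑ n ∈ Finset.Icc 1 N, (if n < m then F m n else 0) = U :=
    Finset.sum_comm
  calc ∑ m ∈ Finset.Icc 1 N, ∑ n ∈ Finset.Icc 1 N, F m n
      = ∑ m ∈ Finset.Icc 1 N, ∑ n ∈ Finset.Icc 1 N, ((if m = n then F m n else 0)
        + (if m < n then F n m else 0) + (if n < m then F m n else 0)) :=
        Finset.sum_congr rfl fun m _ => Finset.sum_congr rfl fun n _ => hsplit m n
    _ ≤ _ := by
        simp only [Finset.sum_add_distrib]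
        rw [hU2]
        linarith

/-- The integrals of `‖S_N‖ ^ 2 / N ^ 3` are summable, so by Tonelli the series itself converges
almost everywhere. -/
theorem ae_tendsto_average_expChar (μ : Measure ℝ) [IsProbabilityMeasure μ] (h : ℤ) (r : ℕ)
    (hs : Summable (fun N : ℕ => fourierDoubleSum μ h r N / (N : ℝ) ^ 3)) :
    ∀ᵐ x ∂μ, Tendsto (fun N : ℕ => (∑ n ∈ Finset.range N, expChar (h * (r : ℤ) ^ n) x) / (N : ℂ))
      atTop (𝓝 0) := by
  set g : ℕ → ℝ → ℝ := fun N x =>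
    ‖∑ n ∈ Finset.Icc 1 N, expChar (h * (r : ℤ) ^ n) x‖ ^ 2 / (N : ℝ) ^ 3 with hg
  have hcont (N : ℕ) : Continuous fun x => ‖∑ n ∈ Finset.Icc 1 N, expChar (h * (r : ℤ) ^ n) x‖ ^ 2 :=
    (continuous_finsetSum _ fun n _ => continuous_expChar _).norm.pow 2
  have hg0 (N : ℕ) (x : ℝ) : 0 ≤ g N x := by positivity
  have hgm (N : ℕ) : Measurable (g N) := ((hcont N).div_const _).measurable
  have hgi (N : ℕ) : Integrable (g N) μ := by
    refine Integrable.div_const ?_ _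
    refine (integrable_const ((N : ℝ) ^ 2)).mono' (hcont N).aestronglyMeasurable
      (Eventually.of_forall fun x => ?_)
    rw [norm_pow, norm_norm]
    gcongr
    refine (norm_sum_le _ _).trans ?_
    simp [norm_expChar]
  have hint (N : ℕ) : ∫ x, g N x ∂μ ≤ 1 / (N : ℝ) ^ 2
      + 2 * (fourierDoubleSum μ h r N / (N : ℝ) ^ 3) := by
    rw [integral_div]
    rcases Nat.eq_zero_or_pos N with rfl | hN
    · simp
    have hN' : (0 : ℝ) < N := by exact_mod_cast hN
    calc _ ≤ (N + 2 * fourierDoubleSum μ h r N) / (N : ℝ) ^ 3 := by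
          gcongr
          exact (integral_sq_norm_sum_expChar_le μ _ _).trans
            (sum_norm_fourierCoefficient_sub_le μ h r N)
      _ = _ := by field_simp
  have hsum : Summable fun N => ∫ x, g N x ∂μ :=
    Summable.of_nonneg_of_le (fun N => integral_nonneg (hg0 N)) hint
      ((Real.summable_one_div_nat_pow.2 (by norm_num)).add (hs.mul_left 2))
  have hfin : ∫⁻ x, ∑' N, ENNReal.ofReal (g N x) ∂μ ≠ ⊤ := by
    rw [lintegral_tsum fun N => (hgm N).ennreal_ofReal.aemeasurable]
    simp only [← ofReal_integral_eq_lintegral_ofReal (hgi _) (Eventually.of_forall (hg0 _))]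
    rw [← ENNReal.ofReal_tsum_of_nonneg (fun N => integral_nonneg (hg0 N)) hsum]
    exact ENNReal.ofReal_ne_top
  filter_upwards [ae_lt_top (Measurable.tsum fun N => (hgm N).ennreal_ofReal) hfin]
    with x hx
  refine tendsto_average_zero_of_summable (fun n => (norm_expChar _ x).le) ?_
  have := ENNReal.summable_toReal hx.ne
  simpa only [ENNReal.toReal_ofReal (hg0 _ x)] using this

/-! ### Weyl's criterion -/

lemma tendsto_average_fourier_span {z : ℕ → UnitAddCircle}
    (hz : ∀ h : ℤ, h ≠ 0 →
      Tendsto (fun N : ℕ => (∑ n ∈ Finset.range N, fourier h (z n)) / (N : ℂ)) atTop (𝓝 0))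
    {f : C(UnitAddCircle, ℂ)}
    (hf : f ∈ Submodule.span ℂ (Set.range (@fourier (1 : ℝ)))) :
    Tendsto (fun N : ℕ => (∑ n ∈ Finset.range N, f (z n)) / (N : ℂ)) atTop
      (𝓝 (∫ t, f t ∂AddCircle.haarAddCircle)) := by
  have hint (g : C(UnitAddCircle, ℂ)) : Integrable (fun t => g t) AddCircle.haarAddCircle :=
    g.continuous.integrable_of_hasCompactSupport (HasCompactSupport.of_compactSpace g)
  induction hf using Submodule.span_induction with
  | mem f hf =>
    obtain ⟨h, rfl⟩ := hf
    by_cases hh : h = 0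
    · subst hh
      simp only [fourier_zero, integral_const, probReal_univ, one_smul, Finset.sum_const,
        Finset.card_range, nsmul_eq_mul, mul_one]
      refine tendsto_const_nhds.congr' ?_
      filter_upwards [eventually_ge_atTop 1] with N hN
      rw [div_self (by exact_mod_cast (by omega : N ≠ 0))]
    · have : ∫ t : UnitAddCircle, fourier h t ∂AddCircle.haarAddCircle = 0 :=
        integral_eq_zero_of_add_right_eq_neg (μ := AddCircle.haarAddCircle)
          (fourier_add_half_inv_index hh one_pos)
      rw [this]
      exact hz h hh
  | zero => simp
  | add f g _ _ hf hg =>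
    simp only [ContinuousMap.add_apply, Finset.sum_add_distrib, add_div]
    rw [integral_add (hint f) (hint g)]
    exact hf.add hg
  | smul c f _ hf =>
    simp only [ContinuousMap.smul_apply, smul_eq_mul, ← Finset.mul_sum, mul_div_assoc]
    rw [integral_const_mul]
    exact hf.const_mul c

/-- Trigonometric polynomials are uniformly dense in the continuous functions on the circle. -/
lemma tendsto_average_continuousMap {z : ℕ → UnitAddCircle}
    (hz : ∀ h : ℤ, h ≠ 0 →
      Tendsto (fun N : ℕ => (∑ n ∈ Finset.range N, fourier h (z n)) / (N : ℂ)) atTop (𝓝 0))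
    (f : C(UnitAddCircle, ℂ)) :
    Tendsto (fun N : ℕ => (∑ n ∈ Finset.range N, f (z n)) / (N : ℂ)) atTop
      (𝓝 (∫ t, f t ∂AddCircle.haarAddCircle)) := by
  have hint (g : C(UnitAddCircle, ℂ)) : Integrable (fun t => g t) AddCircle.haarAddCircle :=
    g.continuous.integrable_of_hasCompactSupport (HasCompactSupport.of_compactSpace g)
  have hmem : f ∈ (Submodule.span ℂ (Set.range (@fourier (1 : ℝ)))).topologicalClosure := by
    rw [span_fourier_closure_eq_top]
    trivial
  rw [← SetLike.mem_coe, Submodule.topologicalClosure_coe, Metric.mem_closure_iff] at hmem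
  rw [Metric.tendsto_atTop]
  intro δ hδ
  obtain ⟨g, hg, hfg⟩ := hmem (δ / 3) (by positivity)
  obtain ⟨N₀, hN₀⟩ := Metric.tendsto_atTop.1 (tendsto_average_fourier_span hz hg) (δ / 3)
    (by positivity)
  have hpt (t : UnitAddCircle) : ‖f t - g t‖ ≤ δ / 3 := by
    rw [← ContinuousMap.sub_apply]
    refine ((f - g).norm_coe_le_norm t).trans ?_
    rw [← dist_eq_norm]
    exact hfg.le
  refine ⟨N₀, fun N hN => ?_⟩
  have h1 : dist ((∑ n ∈ Finset.range N, f (z n)) / (N : ℂ))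
      ((∑ n ∈ Finset.range N, g (z n)) / (N : ℂ)) ≤ δ / 3 := by
    rw [dist_eq_norm, ← sub_div, ← Finset.sum_sub_distrib, norm_div, Complex.norm_natCast]
    refine div_le_of_le_mul₀ (by positivity) (by positivity) ?_
    refine (norm_sum_le_of_le _ fun n _ => hpt (z n)).trans ?_
    simp [mul_comm]
  have h2 : dist (∫ t, g t ∂AddCircle.haarAddCircle) (∫ t, f t ∂AddCircle.haarAddCircle)
      ≤ δ / 3 := by
    rw [dist_comm, dist_eq_norm, ← integral_sub (hint f) (hint g)]
    refine (norm_integral_le_of_norm_le_const (Eventually.of_forall hpt)).trans ?_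
    simp
  have h3 := hN₀ N hN
  have h4 := dist_triangle4 ((∑ n ∈ Finset.range N, f (z n)) / (N : ℂ))
    ((∑ n ∈ Finset.range N, g (z n)) / (N : ℂ)) (∫ t, g t ∂AddCircle.haarAddCircle)
    (∫ t, f t ∂AddCircle.haarAddCircle)
  linarith

/-- The empirical measure of the first `N + 1` points of a sequence. -/
def empiricalMeasure {X : Type*} [MeasurableSpace X] (z : ℕ → X) (N : ℕ) : Measure X :=
  ENNReal.ofReal (N + 1 : ℝ)⁻¹ • ∑ n ∈ Finset.range (N + 1), Measure.dirac (z n)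

instance empiricalMeasure_isProbabilityMeasure {X : Type*} [MeasurableSpace X] (z : ℕ → X)
    (N : ℕ) : IsProbabilityMeasure (empiricalMeasure z N) := by
  constructor
  rw [empiricalMeasure, Measure.smul_apply, Measure.finsetSum_apply]
  simp only [measure_univ, Finset.sum_const, Finset.card_range, nsmul_eq_mul, mul_one, smul_eq_mul]
  rw [← ENNReal.ofReal_natCast, ← ENNReal.ofReal_mul (by positivity)]
  push_cast
  rw [inv_mul_cancel₀ (by positivity), ENNReal.ofReal_one]

lemma integral_empiricalMeasure (z : ℕ → UnitAddCircle) (N : ℕ) (f : C(UnitAddCircle, ℂ)) :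
    ∫ t, f t ∂(empiricalMeasure z N)
      = (∑ n ∈ Finset.range (N + 1), f (z n)) / ((N + 1 : ℕ) : ℂ) := by
  have hint (n : ℕ) : Integrable (fun t => f t) (Measure.dirac (z n)) :=
    f.continuous.integrable_of_hasCompactSupport (HasCompactSupport.of_compactSpace f)
  rw [empiricalMeasure, integral_smul_measure, integral_finsetSum_measure fun n _ => hint n,
    ENNReal.toReal_ofReal (by positivity)]
  simp only [integral_dirac]
  rw [Complex.real_smul]
  push_cast
  rw [div_eq_inv_mul]

lemma empiricalMeasure_real_apply (z : ℕ → UnitAddCircle) (N : ℕ) (E : Set UnitAddCircle)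
    [DecidablePred fun n => z n ∈ E] :
    (empiricalMeasure z N E).toReal
      = ((Finset.range (N + 1)).filter (fun n => z n ∈ E)).card / ((N + 1 : ℕ) : ℝ) := by
  rw [empiricalMeasure, Measure.smul_apply, Measure.finsetSum_apply, smul_eq_mul,
    ENNReal.toReal_mul, ENNReal.toReal_ofReal (by positivity), ENNReal.toReal_sum fun n _ => measure_ne_top _ _]
  simp only [Measure.dirac_apply, Set.indicator_apply, Pi.one_apply, apply_ite ENNReal.toReal,
    ENNReal.toReal_one, ENNReal.toReal_zero]
  rw [Finset.sum_boole]
  push_cast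
  rw [div_eq_inv_mul]

lemma equivIco_one_zero_coe (t : ℝ) :
    ((AddCircle.equivIco (1 : ℝ) 0 (t : UnitAddCircle) : Set.Ico (0 : ℝ) (0 + 1)) : ℝ)
      = Int.fract t := by
  rw [AddCircle.coe_equivIco_mk_apply]
  simp

/-- The arc of the circle corresponding to the interval `[a, b)`. -/
def arc (a b : ℝ) : Set UnitAddCircle :=
  {z | ((AddCircle.equivIco (1 : ℝ) 0 z : Set.Ico (0 : ℝ) (0 + 1)) : ℝ) ∈ Set.Ico a b}

lemma coe_mem_arc {a b t : ℝ} : (t : UnitAddCircle) ∈ arc a b ↔ Int.fract t ∈ Set.Ico a b := by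
  rw [arc, Set.mem_ofPred_eq, equivIco_one_zero_coe]

lemma measurableSet_arc (a b : ℝ) : MeasurableSet (arc a b) :=
  (measurable_subtype_coe.comp (AddCircle.measurableEquivIco (1 : ℝ) 0).measurable)
    measurableSet_Ico

lemma haarAddCircle_unit_eq_volume :
    (AddCircle.haarAddCircle : Measure UnitAddCircle) = volume := by
  rw [AddCircle.volume_eq_smul_haarAddCircle, ENNReal.ofReal_one, one_smul]

lemma haarAddCircle_apply {E : Set UnitAddCircle} (hE : MeasurableSet E) :
    AddCircle.haarAddCircle E = volume ((fun t : ℝ => (t : UnitAddCircle)) ⁻¹' E ∩ Set.Ioo 0 1) := by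
  have h := AddCircle.measurePreserving_mk (1 : ℝ) 0
  rw [haarAddCircle_unit_eq_volume, ← h.measure_preimage hE.nullMeasurableSet, zero_add,
    ← Measure.restrict_congr_set Ioo_ae_eq_Ioc, Measure.restrict_apply (h.measurable hE)]

lemma haarAddCircle_arc {a b : ℝ} (ha : 0 ≤ a) (hb : b ≤ 1) :
    AddCircle.haarAddCircle (arc a b) = ENNReal.ofReal (b - a) := by
  rw [haarAddCircle_apply (measurableSet_arc a b)]
  have hpre : (fun t : ℝ => (t : UnitAddCircle)) ⁻¹' arc a b ∩ Set.Ioo 0 1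
      = Set.Ico a b ∩ Set.Ioo 0 1 := by
    ext t
    simp only [Set.mem_inter_iff, Set.mem_preimage, coe_mem_arc]
    refine and_congr_left fun ht => ?_
    rw [Int.fract_eq_self.2 ⟨ht.1.le, ht.2⟩]
  rw [hpre]
  refine le_antisymm ((measure_mono Set.inter_subset_left).trans_eq Real.volume_Ico) ?_
  rw [← Real.volume_Ioo]
  exact measure_mono fun t ht => ⟨⟨ht.1.le, ht.2⟩, ha.trans_lt ht.1, ht.2.trans_le hb⟩

lemma haarAddCircle_singleton (z : UnitAddCircle) : AddCircle.haarAddCircle {z} = 0 := by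
  obtain ⟨t, rfl⟩ := QuotientAddGroup.mk_surjective z
  rw [haarAddCircle_apply (measurableSet_singleton _)]
  refine Set.Countable.measure_zero ?_ _
  refine (Set.countable_range fun n : ℤ => t + n).mono fun s hs => ?_
  have h1 : (s : UnitAddCircle) = (t : UnitAddCircle) := hs.1
  have h2 : ((s - t : ℝ) : UnitAddCircle) = 0 := by
    rw [AddCircle.coe_sub, h1, sub_self]
  obtain ⟨n, hn⟩ := AddCircle.coe_eq_zero_iff (1 : ℝ) |>.1 h2
  refine ⟨n, ?_⟩
  simp only [zsmul_eq_mul, mul_one] at hn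
  simp only [hn]
  ring

/-- The arc lies between the images of `(a, b)`, which is open, and `[a, b]`, which is closed; only
the two endpoints can be on the frontier. -/
lemma haarAddCircle_frontier_arc {a b : ℝ} (ha : 0 ≤ a) (hb : b ≤ 1) :
    AddCircle.haarAddCircle (frontier (arc a b)) = 0 := by
  have hF : closure (arc a b) ⊆ (fun t : ℝ => (t : UnitAddCircle)) '' Set.Icc a b := by
    refine closure_minimal (fun z hz => ?_) ?_
    · refine ⟨_, ⟨hz.1, hz.2.le⟩, ?_⟩
      exact (AddCircle.equivIco (1 : ℝ) 0).symm_apply_apply z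
    · exact (isCompact_Icc.image (AddCircle.continuous_mk' (1 : ℝ))).isClosed
  have hG : (fun t : ℝ => (t : UnitAddCircle)) '' Set.Ioo a b ⊆ interior (arc a b) := by
    refine interior_maximal ?_ (QuotientAddGroup.isOpenMap_coe _ isOpen_Ioo)
    rintro _ ⟨t, ht, rfl⟩
    refine coe_mem_arc.2 ?_
    rw [Int.fract_eq_self.2 ⟨ha.trans ht.1.le, ht.2.trans_le hb⟩]
    exact ⟨ht.1.le, ht.2⟩
  have hsub : frontier (arc a b) ⊆ {(a : UnitAddCircle)} ∪ {(b : UnitAddCircle)} := by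
    rintro z ⟨hz1, hz2⟩
    obtain ⟨t, ht, rfl⟩ := hF hz1
    by_cases h1 : t = a
    · left; rw [h1]; rfl
    by_cases h2 : t = b
    · right; rw [h2]; rfl
    exact absurd (hG ⟨t, ⟨lt_of_le_of_ne ht.1 (Ne.symm h1), lt_of_le_of_ne ht.2 h2⟩, rfl⟩) hz2
  exact measure_mono_null hsub
    (measure_union_null (haarAddCircle_singleton _) (haarAddCircle_singleton _))

/-- Empirical measures converge weakly to Haar measure, and the portmanteau theorem applies to arcs,
whose frontiers are null. -/
theorem tendsto_card_fract_mem_Ico {y : ℕ → ℝ}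
    (hy : ∀ h : ℤ, h ≠ 0 →
      Tendsto (fun N : ℕ => (∑ n ∈ Finset.range N, fourier h (y n : UnitAddCircle)) / (N : ℂ))
        atTop (𝓝 0)) {a b : ℝ} (ha : 0 ≤ a) (hb : b ≤ 1) (hab : a ≤ b) :
    Tendsto (fun N : ℕ => (((Finset.range N).filter
      (fun n => Int.fract (y n) ∈ Set.Ico a b)).card : ℝ) / (N : ℝ)) atTop (𝓝 (b - a)) := by
  classical
  set z : ℕ → UnitAddCircle := fun n => (y n : UnitAddCircle) with hz
  let P : ℕ → ProbabilityMeasure UnitAddCircle := fun N => ⟨empiricalMeasure z N, inferInstance⟩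
  let Q : ProbabilityMeasure UnitAddCircle := ⟨AddCircle.haarAddCircle, inferInstance⟩
  have hlim : Tendsto P atTop (𝓝 Q) := by
    rw [ProbabilityMeasure.tendsto_iff_forall_integral_rclike_tendsto ℂ]
    intro f
    have h := (tendsto_add_atTop_iff_nat 1).2 (tendsto_average_continuousMap hy f.toContinuousMap)
    refine h.congr fun N => ?_
    exact (integral_empiricalMeasure z N f.toContinuousMap).symm
  have hE := ProbabilityMeasure.tendsto_measure_of_null_frontier_of_tendsto' hlim
    (E := arc a b) (haarAddCircle_frontier_arc ha hb)
  have hE' : Tendsto (fun N => (empiricalMeasure z N (arc a b)).toReal) atTop (𝓝 (b - a)) := by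
    have h := (ENNReal.tendsto_toReal (measure_ne_top _ _)).comp hE
    have e : ((Q : Measure UnitAddCircle) (arc a b)).toReal = b - a := by
      change (AddCircle.haarAddCircle (arc a b)).toReal = b - a
      rw [haarAddCircle_arc ha hb, ENNReal.toReal_ofReal (by linarith)]
    rw [e] at h
    exact h
  rw [← tendsto_add_atTop_iff_nat 1]
  refine hE'.congr fun N => ?_
  rw [empiricalMeasure_real_apply]
  congr 3
  refine Finset.filter_congr fun n _ => ?_
  exact coe_mem_arc

/-! ### Digits -/

/-- The integer part of `b ^ n * {x}` contributes a multiple of `b ^ m`, invisible modulo `b`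
because `m ≥ 1`. -/
lemma digit_add {b : ℕ} (x : ℝ) (n : ℕ) {m : ℕ} (hm : 1 ≤ m) :
    digit b x (n + m) = digit b ((b : ℝ) ^ n * x) m := by
  have h0 := Int.fract_nonneg x
  have hfr : Int.fract ((b : ℝ) ^ n * x) = Int.fract (Int.fract x * (b : ℝ) ^ n) := by
    rw [Int.fract_eq_fract]
    refine ⟨b ^ n * ⌊x⌋, ?_⟩
    rw [Int.fract]
    push_cast
    ring
  set w := Int.fract x * (b : ℝ) ^ n with hw
  have hw0 : 0 ≤ w := by positivity
  have hsplit : w = Int.fract w + (⌊w⌋₊ : ℝ) := by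
    rw [natCast_floor_eq_intCast_floor hw0, Int.fract_add_floor]
  unfold digit
  rw [hfr, pow_add, ← mul_assoc, ← hw]
  have e : w * (b : ℝ) ^ m = Int.fract w * (b : ℝ) ^ m + ((⌊w⌋₊ * b ^ m : ℕ) : ℝ) := by
    conv_lhs => rw [hsplit]
    push_cast
    ring
  have h1 := Int.fract_nonneg w
  rw [e, Nat.floor_add_natCast (by positivity)]
  obtain ⟨i, rfl⟩ := Nat.exists_eq_add_of_le' hm
  rw [pow_succ b i, ← mul_assoc, Nat.add_mul_mod_self_right]

/-- `D` is the integer with base-`b` digits `d 0, …, d (k - 1)`, so a block of digits amounts to an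
interval of length `b ^ (-k)` for the fractional part. -/
lemma exists_digits_iff_floor {b : ℕ} (hb : 0 < b) (k : ℕ) (d : ℕ → ℕ) (hd : ∀ i, d i < b) :
    ∃ D < b ^ k, ∀ y : ℝ, (∀ i < k, digit b y (i + 1) = d i) ↔ ⌊Int.fract y * (b : ℝ) ^ k⌋₊ = D := by
  induction k with
  | zero =>
    refine ⟨0, by simp, fun y => ?_⟩
    simp [Int.fract_lt_one]
  | succ k ih =>
    obtain ⟨D, hD, h⟩ := ih
    refine ⟨D * b + d k, ?_, fun y => ?_⟩
    · rw [pow_succ]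
      have := hd k
      nlinarith
    · have hdiv : ⌊Int.fract y * (b : ℝ) ^ (k + 1)⌋₊ / b = ⌊Int.fract y * (b : ℝ) ^ k⌋₊ := by
        rw [← Nat.floor_div_natCast]
        congr 1
        have hb' : (b : ℝ) ≠ 0 := by exact_mod_cast hb.ne'
        rw [pow_succ, ← mul_assoc, mul_div_cancel_right₀ _ hb']
      rw [Nat.forall_lt_succ_right, h y, ← hdiv, digit]
      set A := ⌊Int.fract y * (b : ℝ) ^ (k + 1)⌋₊
      constructor
      · rintro ⟨h1, h2⟩
        rw [← h1, ← h2, Nat.div_add_mod']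
      · intro h1
        rw [h1]
        constructor
        · rw [mul_comm, Nat.mul_add_div hb, Nat.div_eq_of_lt (hd k), add_zero]
        · rw [mul_comm, Nat.mul_add_mod, Nat.mod_eq_of_lt (hd k)]

theorem isNormalInBase_of_tendsto_average {b : ℕ} (hb : 0 < b) {x : ℝ}
    (hx : ∀ h : ℤ, h ≠ 0 →
      Tendsto (fun N : ℕ => (∑ n ∈ Finset.range N, expChar (h * (b : ℤ) ^ n) x) / (N : ℂ))
        atTop (𝓝 0)) : IsNormalInBase b x := by
  intro k _ d
  have hbk : (0 : ℝ) < (b : ℝ) ^ k := by positivity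
  obtain ⟨D, hD, hiff⟩ := exists_digits_iff_floor hb k
    (fun i => if h : i < k then (d ⟨i, h⟩ : ℕ) else 0) (fun i => by
      split_ifs with h
      · exact (d ⟨i, h⟩).2
      · exact hb)
  have hD' : (D : ℝ) + 1 ≤ (b : ℝ) ^ k := by exact_mod_cast hD
  have hy : ∀ h : ℤ, h ≠ 0 →
      Tendsto (fun N : ℕ => (∑ n ∈ Finset.range N,
        fourier h (((b : ℝ) ^ n * x : ℝ) : UnitAddCircle)) / (N : ℂ)) atTop (𝓝 0) := by
    intro h hh
    refine (hx h hh).congr fun N => ?_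
    congr 1
    refine Finset.sum_congr rfl fun n _ => ?_
    rw [fourier_coe_apply, expChar]
    congr 1
    push_cast
    ring
  have hlim := tendsto_card_fract_mem_Ico hy (a := D / (b : ℝ) ^ k) (b := (D + 1) / (b : ℝ) ^ k)
    (by positivity) ((div_le_one hbk).2 hD') (by gcongr; linarith)
  rw [show ((D : ℝ) + 1) / (b : ℝ) ^ k - D / (b : ℝ) ^ k = 1 / (b : ℝ) ^ k by ring] at hlim
  refine hlim.congr fun N => ?_
  congr 2
  -- The first `k` digits of `b ^ n * x` are those of `x` at positions `n + 1, …, n + k`; exponents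
  -- start at 0, positions at 1.
  refine Finset.card_bij (fun n _ => n + 1) (fun n hn => ?_) (fun _ _ _ _ h => by omega)
    fun n hn => ?_
  all_goals
    have key (n : ℕ) : Int.fract ((b : ℝ) ^ n * x) ∈
          Set.Ico ((D : ℝ) / (b : ℝ) ^ k) ((D + 1) / (b : ℝ) ^ k)
        ↔ ∀ i : Fin k, digit b x (n + 1 + (i : ℕ)) = (d i : ℕ) := by
      have h0 := Int.fract_nonneg ((b : ℝ) ^ n * x)
      rw [Set.mem_Ico, div_le_iff₀ hbk, lt_div_iff₀ hbk,
        ← Nat.floor_eq_iff (by positivity), ← hiff]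
      constructor
      · intro h i
        have := h i i.2
        rw [dif_pos i.2, ← digit_add x n (by omega)] at this
        rw [← this]
        congr 1
        ring
      · intro h i hi
        rw [dif_pos hi, ← digit_add x n (by omega), ← h ⟨i, hi⟩]
        congr 1
        ring
  · simp only [Finset.mem_filter, Finset.mem_range, Finset.mem_Icc] at hn ⊢
    exact ⟨by omega, (key n).1 hn.2⟩
  · simp only [Finset.mem_filter, Finset.mem_range, Finset.mem_Icc] at hn ⊢
    obtain ⟨m, rfl⟩ := Nat.exists_eq_add_of_le' hn.1.1
    exact ⟨m, ⟨by omega, (key m).2 hn.2⟩, rfl⟩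

/-! ### The support of the measure and the two parameter choices -/

/-- Since `ε 1 = 1`, the first block is `δ(0)`; the later ones add up to at most `2 ^ (-κ 1) = 1 /
2`, which excludes the endpoint 1. -/
lemma IsSpecialChoice.ae_mem_Ico {K : ℕ} {κ : ℕ → ℕ} {ε : ℕ → I} (hκ : IsSpecialChoice K κ ε) :
    ∀ᵐ x ∂(skewMeasure κ ε), x ∈ Set.Ico (0 : ℝ) 1 := by
  have hε : (ε 1 : ℝ) = 1 := by
    rw [hκ.eq_specialEps 1 le_rfl]
    simp [specialEps]
  have hblock : blockMeasure κ ε (0 + 1) = Measure.dirac 0 := by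
    simp [blockMeasure, hε]
  have h0 : ∀ᵐ x ∂(Measure.infinitePi fun i => blockMeasure κ ε (i + 1)), x 0 = 0 := by
    refine (measurePreserving_eval_infinitePi (fun i => blockMeasure κ ε (i + 1))
      0).quasiMeasurePreserving.ae (p := fun y => y = 0) ?_
    rw [hblock]
    exact (ae_dirac_iff (measurableSet_singleton 0)).2 rfl
  have h1 : ∀ᵐ x ∂(Measure.infinitePi fun i => blockMeasure κ ε (i + 1)), ∀ i,
      x i ∈ Set.Icc (0 : ℝ) ((2 : ℝ)⁻¹ ^ κ i - (2 : ℝ)⁻¹ ^ κ (i + 1)) :=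
    ae_all_iff.2 fun i =>
      (measurePreserving_eval_infinitePi (fun i => blockMeasure κ ε (i + 1))
        i).quasiMeasurePreserving.ae (blockMeasure_mem_Icc κ hκ.mono ε i)
  refine (ae_map_iff measurable_tsum_coord.aemeasurable measurableSet_Ico).2 ?_
  filter_upwards [h0, h1] with x hx0 hx
  refine ⟨tsum_nonneg fun i => (hx i).1, ?_⟩
  have hle : ∑' i, x i ≤ 1 / 2 := by
    refine Real.tsum_le_of_sum_range_le (fun i => (hx i).1) fun n => ?_
    rcases n with _ | n
    · simp
    rw [Finset.sum_range_succ', hx0, add_zero]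
    calc ∑ i ∈ Finset.range n, x (i + 1)
        ≤ ∑ i ∈ Finset.range n, ((2 : ℝ)⁻¹ ^ κ (i + 1) - (2 : ℝ)⁻¹ ^ κ (i + 1 + 1)) :=
          Finset.sum_le_sum fun i _ => (hx (i + 1)).2
      _ = (2 : ℝ)⁻¹ ^ κ (0 + 1) - (2 : ℝ)⁻¹ ^ κ (n + 1) :=
          Finset.sum_range_sub' (fun i => (2 : ℝ)⁻¹ ^ κ (i + 1)) n
      _ ≤ (2 : ℝ)⁻¹ ^ κ (0 + 1) := sub_le_self _ (by positivity)
      _ = 1 / 2 := by rw [zero_add, hκ.one]; norm_num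
  linarith

theorem IsSpecialChoice.hasOddBaseProperty {K : ℕ} (hK : 10 ≤ K) {κ : ℕ → ℕ} {ε : ℕ → I}
    (hκ : IsSpecialChoice K κ ε) : HasOddBaseProperty (skewMeasure κ ε) := by
  have hsum (r : ℕ) (hr : r ∈ oddBases) (h : ℤ) (hh : h ≠ 0) :=
    hκ.summable_fourierDoubleSum hK hr hh
  refine ⟨hsum, ?_⟩
  have hae : ∀ᵐ x ∂(skewMeasure κ ε), ∀ r : ℕ, ∀ h : ℤ, r ∈ oddBases → h ≠ 0 →
      Tendsto (fun N : ℕ => (∑ n ∈ Finset.range N, expChar (h * (r : ℤ) ^ n) x) / (N : ℂ))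
        atTop (𝓝 0) := by
    refine ae_all_iff.2 fun r => ae_all_iff.2 fun h => ?_
    by_cases hr : r ∈ oddBases
    · by_cases hh : h = 0
      · exact Eventually.of_forall fun x _ h0 => absurd hh h0
      · filter_upwards [ae_tendsto_average_expChar _ h r (hsum r hr h hh)] with x hx _ _
        exact hx
    · exact Eventually.of_forall fun x h0 => absurd h0 hr
  filter_upwards [hae, hκ.ae_mem_Ico] with x hx hx1
  refine ⟨fun r hr => ?_, hx1⟩
  exact isNormalInBase_of_tendsto_average (by have := hr.1; omega) fun h hh => hx r h hr hh

lemma specialK_one (K : ℕ) : specialK K 1 = 1 := by simp [specialK]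

lemma isSpecialChoice_specialK {K : ℕ} (hK : 1 ≤ K) :
    IsSpecialChoice K (specialK K) specialEps where
  mono := specialK_monotone hK
  zero := by simp [specialK]
  one := specialK_one K
  eq_specialK _ _ := rfl
  eq_specialEps _ _ := rfl

/-- `specialK K 1 = specialK K 2 = 1` because `√(log 2) < 1`. Raising the value at 2 to 2 restores
strictness without affecting the indices `l ≥ 3`. -/
lemma strictMono_update_specialK {K : ℕ} (hK : 10 ≤ K) :
    StrictMono (Function.update (specialK K) 2 2) := by
  refine strictMono_nat_of_lt_succ fun l => ?_
  rcases Nat.lt_or_ge l 3 with hl | hl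
  · have h3 : 10 ^ 3 ≤ specialK K 3 :=
      (Nat.pow_le_pow_left hK 3).trans (pow_le_specialK (by omega) le_rfl)
    interval_cases l
    · simp [Function.update, specialK]
    · simp [Function.update, specialK]
    · simp only [Function.update_self, Nat.reduceAdd, ne_eq, Nat.reduceEqDiff, not_false_eq_true,
        Function.update_of_ne]
      omega
  · rw [Function.update_of_ne (by omega), Function.update_of_ne (by omega)]
    have := two_mul_succ_le_sub_specialK hK hl
    omega

lemma isSpecialChoice_update_specialK {K : ℕ} (hK : 10 ≤ K) :
    IsSpecialChoice K (Function.update (specialK K) 2 2) specialEps where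
  mono := (strictMono_update_specialK hK).monotone
  zero := by simp [Function.update, specialK]
  one := by simp [Function.update, specialK]
  eq_specialK l hl := Function.update_of_ne (by omega) _ _
  eq_specialEps _ _ := rfl

lemma isParameterChoice_update_specialK {K : ℕ} (hK : 10 ≤ K) :
    IsParameterChoice (Function.update (specialK K) 2 2) specialEps := by
  refine ⟨strictMono_update_specialK hK, (isSpecialChoice_update_specialK hK).zero, fun h => ?_⟩
  exact Real.not_summable_one_div_natCast
    ((summable_nat_add_iff (f := fun l : ℕ => 1 / (l : ℝ)) 1).1 h)

end OddNormal

end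

theorem proposition4p2 (K : ℕ) (hK : 10 ≤ K) :
    (∃ (K' : ℕ → ℕ) (ε : ℕ → unitInterval),
      OddNormal.IsParameterChoice K' ε ∧
      (∀ l : ℕ, 3 ≤ l → K' l = OddNormal.specialK K l) ∧
      (∀ l : ℕ, 1 ≤ l → ε l = OddNormal.specialEps l) ∧
      OddNormal.HasOddBaseProperty (OddNormal.skewMeasure K' ε)) ∧
    OddNormal.HasOddBaseProperty
      (OddNormal.skewMeasure (OddNormal.specialK K) OddNormal.specialEps) := by
  have h1 := OddNormal.isSpecialChoice_update_specialK hK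
  have h2 := OddNormal.isSpecialChoice_specialK (show 1 ≤ K by omega)
  exact ⟨⟨_, _, OddNormal.isParameterChoice_update_specialK hK, h1.eq_specialK, h1.eq_specialEps,
    h1.hasOddBaseProperty hK⟩, h2.hasOddBaseProperty hK⟩
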